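/- Let $X$ be an irreducible normal projective variety over $\mathbb{C}$ which is $\mathbb{Q}$-factorial, i.e. every Weil divisor on $X$ has a positive multiple which is Cartier, and let $g:X\to X$ be a surjective morphism (hence a finite one). Let $\mathcal{C}_g$ be its critical divisor, i.e. the unique Weil divisor on $X$ whose restriction to $X_{\mathrm{reg}}\cap g^{-1}(X_{\mathrm{reg}})$ is the Cartier divisor $\{\mathrm{Jac}(g)=0\}$. For a birational morphism $\pi:Y\to X$ from a normal variety $Y$ and a prime divisor $E\subset Y$, write $\mathrm{ord}_E(\varphi)$ for the order of vanishing of $\varphi\circ\pi$ along $E$ of a rational function $\varphi$ on $X$, and $\mathrm{ord}_E(D)=\frac1m\mathrm{ord}_E(\pi^*(mD))$ for a divisor $D$ on $X$, where $m\geq1$ is such that $mD$ is Cartier. The log discrepancy of $E$ is $a_E=\mathrm{ord}_E(K_{Y/X})+1$, where $K_{Y/X}=\mathrm{div}(\pi^*\omega)-\pi^*\mathrm{div}(\omega)$ is the relative canonical divisor; here $\omega$ is a nonzero rational differential form of top degree on $X$, and $K_{Y/X}$ does not depend on its choice. Let $\pi:Y\to X$ and $\pi':Y'\to X$ be two such birational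 morphisms, let $E\subset Y$ and $E'\subset Y'$ be prime divisors, and suppose that the rational lift $\bar g:Y\dashrightarrow Y'$ of $g$ (so that $\pi'\circ\bar g=g\circ\pi$) is defined at the generic point of $E$ and maps it to the generic point of $E'$. Then there is an integer $r\geq1$ such that $g_*\mathrm{ord}_E=r\,\mathrm{ord}_{E'}$, that is, $\mathrm{ord}_E(\varphi\circ g)=r\,\mathrm{ord}_{E'}(\varphi)$ for every nonzero rational function $\varphi$ on $X$, and for this $r$ $$r\,a_{E'}=a_E+\mathrm{ord}_E(\mathcal{C}_g).$$ -/

import Mathlib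

open CategoryTheory AlgebraicGeometry Order
open scoped KaehlerDifferential

noncomputable section

namespace DiscrepancyPullback

/-! ### Complex varieties -/

/-- The base `Spec ℂ`. -/
abbrev SpecC : Scheme.{0} := Spec (CommRingCat.of ℂ)

/-- An (irreducible, reduced) complex variety: an integral separated scheme of finite type
over `ℂ`. -/
class IsVariety (X : Scheme.{0}) [X.Over SpecC] : Prop where
  isIntegral : IsIntegral X
  isSeparated : IsSeparated (X ↘ SpecC)
  locallyOfFiniteType : LocallyOfFiniteType (X ↘ SpecC)
  quasiCompact : QuasiCompact (X ↘ SpecC)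

/-- A scheme is normal if all its local rings are integrally closed domains. -/
class IsNormalScheme (X : Scheme.{0}) : Prop where
  isDomain_stalk : ∀ x : X, IsDomain (X.presheaf.stalk x)
  isIntegrallyClosed_stalk : ∀ x : X, IsIntegrallyClosed (X.presheaf.stalk x)

/-- The graded pieces of the homogeneous coordinate ring `ℂ[x₀, …, x_N]`. -/
abbrev coordGrading (N : ℕ) : ℕ → Submodule ℂ (MvPolynomial (Fin (N + 1)) ℂ) :=
  MvPolynomial.homogeneousSubmodule (Fin (N + 1)) ℂ

instance (N : ℕ) : GradedAlgebra (coordGrading N) := MvPolynomial.gradedAlgebra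

/-- The structure morphism `ℙ^N → Spec ℂ` of complex projective space `Proj ℂ[x₀, …, x_N]`. -/
def projectiveSpaceToSpecC (N : ℕ) : Proj (coordGrading N) ⟶ SpecC :=
  Proj.toSpecZero (coordGrading N) ≫
    Spec.map (CommRingCat.ofHom (algebraMap ℂ (coordGrading N 0)))

/-- `X` is projective: it is a closed subscheme of some complex projective space. -/
class IsProjectiveVariety (X : Scheme.{0}) [X.Over SpecC] : Prop where
  exists_closedImmersion : ∃ (N : ℕ) (i : X ⟶ Proj (coordGrading N)),
    IsClosedImmersion i ∧ i ≫ projectiveSpaceToSpecC N = X ↘ SpecC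

section Variety

variable (X : Scheme.{0}) [X.Over SpecC]

instance [h : IsVariety X] : IsIntegral X := h.isIntegral

instance [h : IsVariety X] : IsLocallyNoetherian X :=
  haveI := h.locallyOfFiniteType
  LocallyOfFiniteType.isLocallyNoetherian (X ↘ SpecC)

/-- The scalars `ℂ → 𝒪_{X,x}`. -/
def scalarsToStalk (x : X) : CommRingCat.of ℂ ⟶ X.presheaf.stalk x :=
  (Scheme.ΓSpecIso (CommRingCat.of ℂ)).inv ≫ (X ↘ SpecC).appTop ≫ X.presheaf.germ ⊤ x (TopologicalSpace.Opens.mem_top x)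

/-- The local rings of `X`, in particular its function field, are `ℂ`-algebras. -/
instance stalkAlgebra (x : X) : Algebra ℂ (X.presheaf.stalk x) :=
  (scalarsToStalk X x).hom.toAlgebra

/-- The dimension of a variety: the transcendence degree of its function field over `ℂ`. -/
def dim [IsVariety X] : ℕ := Cardinal.toNat (Algebra.trdeg ℂ X.functionField)

end Variety

/-! ### Pull-back of rational functions -/

section FunctionField

variable {Y X : Scheme.{0}} (f : Y ⟶ X)

lemma genericPoint_specializes_of_isDominant [IsIntegral Y] [IsIntegral X] [IsDominant f] :
    f (genericPoint Y) ⤳ genericPoint X := by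
  have h := (genericPoint_spec Y).image f.continuous
  rw [Set.image_univ, f.denseRange.closure_range] at h
  exact h.specializes trivial

variable [Y.Over SpecC] [X.Over SpecC] [IsVariety Y] [IsVariety X]

/-- Pull-back of rational functions `φ ↦ φ ∘ f` along a dominant morphism. -/
def pullFun [IsDominant f] [f.IsOver SpecC] : X.functionField →ₐ[ℂ] Y.functionField where
  __ := (X.presheaf.stalkSpecializes (genericPoint_specializes_of_isDominant f) ≫
    f.stalkMap (genericPoint Y)).hom
  commutes' r := by
    have key : scalarsToStalk X (genericPoint X) ≫
        X.presheaf.stalkSpecializes (genericPoint_specializes_of_isDominant f) ≫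
        f.stalkMap (genericPoint Y) = scalarsToStalk Y (genericPoint Y) := by
      have hf : f ≫ (X ↘ SpecC) = Y ↘ SpecC := comp_over f SpecC
      simp only [scalarsToStalk, Category.assoc]
      rw [TopCat.Presheaf.germ_stalkSpecializes_assoc]
      have hf' : (X ↘ SpecC).appTop ≫ f.app ⊤ = (Y ↘ SpecC).appTop := by
        rw [← hf]; exact (Scheme.Hom.comp_appTop f (X ↘ SpecC)).symm
      rw [← hf']
      simp only [TopCat.Presheaf.germ_stalkSpecializes_assoc, Scheme.Hom.germ_stalkMap,
        Category.assoc]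
      rfl
    exact congr($(key).hom r)

end FunctionField

/-- `π : Y ⟶ X` is a birational morphism of varieties: it maps a nonempty open subset of `Y`
isomorphically onto an open subset of `X`. -/
class IsBirationalMorphism {Y X : Scheme.{0}} (π : Y ⟶ X) : Prop where
  exists_open : ∃ U : Y.Opens, (U : Set Y).Nonempty ∧ IsOpenImmersion (U.ι ≫ π)

instance {Y X : Scheme.{0}} [IsIntegral X] (π : Y ⟶ X) [h : IsBirationalMorphism π] :
    IsDominant π := by
  obtain ⟨U, ⟨u, hu⟩, hU⟩ := h.exists_open
  have ho : IsOpen (Set.range (U.ι ≫ π)) := (U.ι ≫ π).isOpenEmbedding.isOpen_range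
  refine ⟨(ho.dense ⟨_, ⟨⟨u, hu⟩, rfl⟩⟩).mono ?_⟩
  rintro _ ⟨v, rfl⟩
  exact ⟨U.ι v, by simp⟩

/-! ### Rational differential forms -/

/-- Differential forms of degree `n` of a `ℂ`-algebra. -/
abbrev Forms (n : ℕ) (K : Type) [CommRing K] [Algebra ℂ K] : Type := ⋀[K]^n (Ω[K⁄ℂ])

/-- The form `ds₁ ∧ ⋯ ∧ dsₙ`. -/
def dWedge {n : ℕ} {K : Type} [CommRing K] [Algebra ℂ K] (s : Fin n → K) : Forms n K :=
  exteriorPower.ιMulti K n (fun i => KaehlerDifferential.D ℂ K (s i))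

/-- The pull-back of forms `h • ds₁ ∧ ⋯ ∧ dsₙ ↦ f(h) • d f(s₁) ∧ ⋯ ∧ d f(sₙ)` along
`f : K → L`. -/
def pullForm (n : ℕ) {K L : Type} [CommRing K] [CommRing L] [Algebra ℂ K] [Algebra ℂ L]
    (f : K →ₐ[ℂ] L) (ω : Forms n K) : Forms n L :=
  letI : Algebra K L := f.toRingHom.toAlgebra
  haveI : IsScalarTower ℂ K L := IsScalarTower.of_algebraMap_eq (fun r => (f.commutes r).symm)
  letI : Module K (Forms n L) := Module.compHom _ f.toRingHom
  exteriorPower.alternatingMapLinearEquiv (R := K) (M := Ω[K⁄ℂ]) (N := Forms n L)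
    { toFun := fun v => exteriorPower.ιMulti L n (fun i => KaehlerDifferential.map ℂ ℂ K L (v i))
      map_update_add' := by
        intro inst v i x y
        obtain rfl : inst = instDecidableEqFin n := Subsingleton.elim _ _
        have h : ∀ z : Ω[K⁄ℂ], (fun j => KaehlerDifferential.map ℂ ℂ K L (Function.update v i z j))
            = Function.update (fun j => KaehlerDifferential.map ℂ ℂ K L (v j)) i
              (KaehlerDifferential.map ℂ ℂ K L z) := fun z =>
          (Function.comp_update _ v i z)
        rw [h, h, h, map_add, AlternatingMap.map_update_add]
      map_update_smul' := by
        intro inst v i c x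
        obtain rfl : inst = instDecidableEqFin n := Subsingleton.elim _ _
        have h : ∀ z : Ω[K⁄ℂ], (fun j => KaehlerDifferential.map ℂ ℂ K L (Function.update v i z j))
            = Function.update (fun j => KaehlerDifferential.map ℂ ℂ K L (v j)) i
              (KaehlerDifferential.map ℂ ℂ K L z) := fun z =>
          (Function.comp_update _ v i z)
        rw [h, h, map_smul, ← algebraMap_smul L c, AlternatingMap.map_update_smul]
        rfl
      map_eq_zero_of_eq' := fun v i j hv hij =>
        (exteriorPower.ιMulti L n (M := Ω[L⁄ℂ])).map_eq_zero_of_eq _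
          (congrArg (KaehlerDifferential.map ℂ ℂ K L) hv) hij } ω

/-! ### Orders of vanishing, divisors -/

section Divisors

variable {X : Scheme.{0}} [X.Over SpecC]

/-- `t₁, …, tₙ ∈ 𝒪_{X,x}` are local coordinates of `X` at `x`: the differentials `dtᵢ` form a basis
of the module of differentials of `𝒪_{X,x}` over `ℂ`. On a variety of dimension `n`, such
coordinates exist exactly at the regular points. -/
def IsLocalCoords {n : ℕ} (x : X) (t : Fin n → X.presheaf.stalk x) : Prop :=
  LinearIndependent (X.presheaf.stalk x)
    (fun i => KaehlerDifferential.D ℂ (X.presheaf.stalk x) (t i)) ∧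
  Submodule.span (X.presheaf.stalk x)
    (Set.range fun i => KaehlerDifferential.D ℂ (X.presheaf.stalk x) (t i)) = ⊤

variable [IsVariety X]

/-- The rational form `dt₁ ∧ ⋯ ∧ dtₙ` on `X` given by functions `tᵢ ∈ 𝒪_{X,x}`. -/
def coordForm {n : ℕ} {x : X} (t : Fin n → X.presheaf.stalk x) : Forms n X.functionField :=
  dWedge fun i => algebraMap (X.presheaf.stalk x) X.functionField (t i)

open Classical in
/-- The order of a rational form `ω` of top degree along the prime divisor with generic
point `x`: if `ω = a dt₁ ∧ ⋯ ∧ dtₙ` with local coordinates `tᵢ` at `x`, it is the order of `a`.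
(`Scheme.ord` is `0` at points which are not of codimension one.) -/
def ordForm {n : ℕ} (ω : Forms n X.functionField) (x : X) : ℤ :=
  if h : ∃ a : X.functionField, ∃ t : Fin n → X.presheaf.stalk x,
      IsLocalCoords x t ∧ ω = a • coordForm t
  then Scheme.ord h.choose x else 0

/-- The divisor `div(ω)` of a rational form of top degree. Divisors with rational coefficients are
given by their multiplicities along prime divisors, the latter being identified with the points
`x` of codimension one, i.e. with `coheight x = 1`. -/
def divForm {n : ℕ} (ω : Forms n X.functionField) (x : X) : ℚ := ordForm ω x

/-- `φ` is a local equation near `y` of the divisor with multiplicities `D`. -/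
def IsLocalEquation (D : X → ℚ) (y : X) (φ : X.functionField) : Prop :=
  φ ≠ 0 ∧ ∃ U : X.Opens, y ∈ U ∧ ∀ z ∈ U, coheight z = 1 → (Scheme.ord φ z : ℚ) = D z

variable (X) in
/-- `X` is `ℚ`-factorial: every Weil divisor (locally finite integral combination of points of
codimension one) has a positive multiple which is Cartier, i.e. which has local equations. -/
def IsQFactorial : Prop :=
  ∀ D : AlgebraicCycle X ℤ, (∀ x, D x ≠ 0 → coheight x = 1) →
    ∃ m : ℕ, 0 < m ∧ ∀ y : X, ∃ φ : X.functionField, IsLocalEquation (fun z => (m * D z : ℚ)) y φ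

variable (X) in
/-- A nonzero rational form of top degree on `X`; its divisor is a canonical divisor `K_X`. -/
def canonicalForm : Forms (dim X) X.functionField :=
  Classical.epsilon fun ω => ω ≠ 0

end Divisors

section Morphisms

variable {Y X : Scheme.{0}} [Y.Over SpecC] [X.Over SpecC] [IsVariety Y] [IsVariety X]

/-- The order of vanishing `ord_E(φ ∘ f)` of a rational function `φ` on `X` along the prime divisor
`E` of `Y` with generic point `e`. -/
def ordFun (f : Y ⟶ X) [IsDominant f] [f.IsOver SpecC] (e : Y) (φ : X.functionField) : ℤ :=
  Scheme.ord (pullFun f φ) e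

open Classical in
/-- The order of vanishing `ord_E(D) = (1/m) ord_E(f^*(mD))` of a `ℚ`-Cartier divisor `D` on `X`
along the prime divisor `E` of `Y` with generic point `e`. Here `f^*(mD)` is given near `e` by
`φ ∘ f` for a local equation `φ` of `mD` near `f e`. -/
def ordDiv (f : Y ⟶ X) [IsDominant f] [f.IsOver SpecC] (e : Y) (D : X → ℚ) : ℚ :=
  if h : ∃ p : ℕ × X.functionField, 0 < p.1 ∧ IsLocalEquation (fun z => p.1 * D z) (f e) p.2
  then (ordFun f e h.choose.2 : ℚ) / h.choose.1 else 0

/-- The divisor `div(f^*ω) - f^* div(ω)` on `Y`, for a nonzero rational form `ω` of top degree on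
`X`. It lies in the class `K_Y - f^*K_X`. Near points where `Y` and `X` both have local coordinates
it is the divisor of the Jacobian determinant of `f`. -/
def canonicalDifference (f : Y ⟶ X) [IsDominant f] [f.IsOver SpecC] (e : Y) : ℚ :=
  divForm (pullForm (dim X) (pullFun f) (canonicalForm X)) e - ordDiv f e (divForm (canonicalForm X))

/-- The relative canonical divisor `K_{Y/X}` of a birational morphism `π : Y ⟶ X`: the
representative `div(π^*ω) - π^* div(ω)` of `K_Y - π^*K_X` in which both canonical divisors are given
by the same rational form, so that it is supported on the exceptional locus. -/
def relCanonicalDivisor (π : Y ⟶ X) [IsBirationalMorphism π] [π.IsOver SpecC] (e : Y) : ℚ :=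
  canonicalDifference π e

/-- The log discrepancy `a_E = ord_E(K_{Y/X}) + 1` of the prime divisor `E` of `Y` with generic
point `e`. -/
def logDiscrepancy (π : Y ⟶ X) [IsBirationalMorphism π] [π.IsOver SpecC] (e : Y) : ℚ :=
  relCanonicalDivisor π e + 1

/-- `J` is the Jacobian determinant of `f` at `y` in some local coordinates `tᵢ` at `y` and `sᵢ` at
`f y`: `d(s₁ ∘ f) ∧ ⋯ ∧ d(sₙ ∘ f) = J dt₁ ∧ ⋯ ∧ dtₙ`. -/
def IsJacobian (f : Y ⟶ X) [IsDominant f] [f.IsOver SpecC] (y : Y) (J : Y.functionField) : Prop :=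
  ∃ (t : Fin (dim X) → Y.presheaf.stalk y) (s : Fin (dim X) → X.presheaf.stalk (f y)),
    IsLocalCoords y t ∧ IsLocalCoords (f y) s ∧
      pullForm (dim X) (pullFun f) (coordForm s) = J • coordForm t

open Classical in
/-- The critical divisor `C_g` of a surjective morphism `g : X ⟶ X`. On the open set
`X_reg ∩ g⁻¹(X_reg)`, i.e. where the Jacobian determinant makes sense, it is the divisor
`{Jac(g) = 0}`. If `X` is normal and projective, then `g` is finite, hence every point of
codimension one lies in that open set, and `C_g` is the unique Weil divisor with this property.
(Elsewhere the multiplicity is that of `div(g^*ω) - g^* div(ω)`, which agrees with the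
multiplicity of the Jacobian determinant wherever both make sense.) -/
def criticalDivisor (g : X ⟶ X) [Surjective g] [g.IsOver SpecC] (x : X) : ℚ :=
  if h : ∃ J : X.functionField, IsJacobian g x J then (Scheme.ord h.choose x : ℚ)
  else canonicalDifference g x

/-- `ḡ(E) = E'` for the rational lift `ḡ : Y ⇢ Y'` of `g : X ⟶ X`, where `E`, `E'` are the prime
divisors with generic points `e`, `e'`: near `e` there is a morphism `h` to `Y'` lifting `g`, and it
maps the generic point of `E` to the generic point of `E'`. -/
def LiftMapsTo {Y' : Scheme.{0}} (g : X ⟶ X) (π : Y ⟶ X) (π' : Y' ⟶ X) (e : Y) (e' : Y') : Prop :=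
  ∃ (U : Y.Opens) (he : e ∈ U) (h : U.toScheme ⟶ Y'), h ≫ π' = U.ι ≫ π ≫ g ∧ h ⟨e, he⟩ = e'

/-- `g_* ord_E = r ord_{E'}` as valuations of the function field of `X`, where
`(g_* ord_E)(φ) = ord_E(φ ∘ g)`. -/
def PushforwardOrdEq {Y' : Scheme.{0}} [Y'.Over SpecC] [IsVariety Y']
    (g : X ⟶ X) [Surjective g] [g.IsOver SpecC] (π : Y ⟶ X) [IsBirationalMorphism π] [π.IsOver SpecC]
    (π' : Y' ⟶ X) [IsBirationalMorphism π'] [π'.IsOver SpecC] (e : Y) (e' : Y') (r : ℕ) : Prop :=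
  ∀ φ : X.functionField, φ ≠ 0 → ordFun π e (pullFun g φ) = r * ordFun π' e' φ

end Morphisms

end DiscrepancyPullback

end

open DiscrepancyPullback

/-!
The formula is a ramification formula, combined with the fact that the critical divisor is
`div(g^*ω) - g^* div(ω)` for a rational form `ω` of top degree.

*Ramification.* The function fields of `X`, `Y` and `Y'` are identified by `π` and `π'`. The lift
of `g` is dominant and makes the local ring of `Y` at `E` an extension of the local ring of `Y'`
at `E'`. Both are discrete valuation rings, so a uniformizer `t'` at `E'` pulls back to `u tʳ`,
with `u` a unit and `t` a uniformizer at `E`; this `r` is the factor in `g_* ord_E = r ord_{E'}`.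
Lifts `s'ᵢ` of a transcendence basis of the residue field at `E'` complete `t'` to local
coordinates, and their pull-backs complete `t` to local coordinates
(`span_D_cons_eq_top_of_isTranscendenceBasis`, `exists_isTranscendenceBasis_stalkMap`). As
`d(u tʳ) ∧ ds = tʳ⁻¹ w dt ∧ ds` with a unit `w` (`dWedge_cons_unit_mul_pow`), pull-back multiplies
`ord(η) + 1` by `r` for every nonzero form `η` of top degree (`exists_ramificationIndex`). For
`η = π'^*ω` this says, in `LiftMapsTo.exists_ramificationIndex`,
`ord_E(π^* g^* ω) + 1 = r (ord_{E'}(π'^* ω) + 1)`.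

*Divisors.* Write `g^*ω = J ω` with a rational function `J`. The Jacobian determinant of `g` has
the multiplicities of `div(g^*ω) - g^* div(ω)` (`criticalDivisor_eq_canonicalDifference`). By
`ℚ`-factoriality there is `m ≥ 1` such that `m div(ω)` has local equations `φ` near `π e` and `ψ`
near `g (π e) = π' e'`, and then `Jᵐ φ / g^*ψ` is a local equation of `m C_g` near `π e`
(`isLocalEquation_criticalDivisor`). Orders of `ℚ`-Cartier divisors may be computed with any local
equation, because two of them differ by a unit at the given point; this rests on the normality of
`X`, through `exists_algebraMap_eq_of_forall_height_eq_one` (`ordDiv_eq`). Inserting these orders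
and `ord_E(π^* g^* ψ) = r ord_{E'}(π'^* ψ)` in the displayed equation gives the theorem.
-/

noncomputable section

namespace DiscrepancyPullback

/-! ### Differentials of fields of characteristic zero -/

section Kaehler
open KaehlerDifferential TensorProduct
open scoped IntermediateField.algebraAdjoinAdjoin in
/-- In characteristic zero a field is formally étale over the polynomial ring on a transcendence
basis: it is separable algebraic over the fraction field of that ring. -/
lemma formallyEtale_adjoin_of_isTranscendenceBasis {k L ι : Type*} [Field k] [CharZero k] [Field L]
    [Algebra k L] {x : ι → L} (hx : IsTranscendenceBasis k x) :
    Algebra.FormallyEtale (Algebra.adjoin k (Set.range x)) L := by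
  have : Algebra.FormallyEtale (Algebra.adjoin k (Set.range x))
      (IntermediateField.adjoin k (Set.range x)) :=
    .of_isLocalization (nonZeroDivisors _)
  have := hx.isAlgebraic_field
  have : CharZero (IntermediateField.adjoin k (Set.range x)) := charZero_of_injective_algebraMap
    (algebraMap k _).injective
  have : Algebra.FormallyEtale (IntermediateField.adjoin k (Set.range x)) L :=
    .of_isSeparable _ L
  exact .comp _ (IntermediateField.adjoin k (Set.range x)) _

lemma exists_basis_D_of_mvPolynomial_algEquiv {k A ι : Type*} [CommRing k] [CommRing A]
    [Algebra k A]
    (e : MvPolynomial ι k ≃ₐ[k] A) :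
    ∃ b : Module.Basis ι A Ω[A⁄k], ∀ i, b i = D k A (e (MvPolynomial.X i)) := by
  algebraize [e.toRingEquiv.toRingHom]
  have : IsScalarTower k (MvPolynomial ι k) A := .of_algebraMap_eq fun r ↦ (e.commutes r).symm
  have : Algebra.FormallyEtale (MvPolynomial ι k) A :=
    .of_equiv (AlgEquiv.ofBijective (Algebra.ofId (MvPolynomial ι k) A) e.bijective)
  refine ⟨((mvPolynomialBasis k ι).baseChange A).map
    (tensorKaehlerEquivOfFormallyEtale k (MvPolynomial ι k) A), fun i ↦ ?_⟩
  simp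
  rfl

lemma exists_basis_D_of_isTranscendenceBasis {k L ι : Type*} [Field k] [CharZero k] [Field L]
    [Algebra k L] {x : ι → L} (hx : IsTranscendenceBasis k x) :
    ∃ b : Module.Basis ι L Ω[L⁄k], ∀ i, b i = D k L (x i) := by
  obtain ⟨b, hb⟩ := exists_basis_D_of_mvPolynomial_algEquiv hx.1.aevalEquiv
  have := formallyEtale_adjoin_of_isTranscendenceBasis hx
  refine ⟨(b.baseChange L).map (tensorKaehlerEquivOfFormallyEtale k _ L), fun i ↦ ?_⟩
  simp [hb]

lemma finrank_kaehlerDifferential {k L : Type} [Field k] [CharZero k] [Field L] [Algebra k L] :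
    Module.finrank L Ω[L⁄k] = Cardinal.toNat (Algebra.trdeg k L) := by
  obtain ⟨s, hs⟩ := exists_isTranscendenceBasis k L
  obtain ⟨b, -⟩ := exists_basis_D_of_isTranscendenceBasis hs
  rw [Module.finrank_eq_nat_card_basis b, ← hs.cardinalMk_eq_trdeg, Nat.card]
end Kaehler

/-! ### Coordinates on discrete valuation rings -/

section Kaehler
open KaehlerDifferential TensorProduct IsLocalRing

/-- If the maximal ideal is generated by `t` and the differentials of the residues of the `sᵢ`
span, then `dt` and the `dsᵢ` span `Ω[R⁄k]`, by Nakayama's lemma and the conormal sequence of the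
residue field. -/
lemma span_D_eq_top_of_residueField {k R ι : Type*} [Field k] [CommRing R] [IsLocalRing R]
    [Algebra k R] [Module.Finite R Ω[R⁄k]] {t : R} (ht : maximalIdeal R = Ideal.span {t})
    {s : ι → R}
    (hs : ⊤ ≤ Submodule.span (ResidueField R)
      (Set.range fun i ↦ D k (ResidueField R) (residue R (s i)))) :
    ⊤ ≤ Submodule.span R (insert (D k R t) (Set.range fun i ↦ D k R (s i))) := by
  set N := Submodule.span R (insert (D k R t) (Set.range fun i ↦ D k R (s i))) with hN
  have htN : D k R t ∈ N := Submodule.subset_span (Set.mem_insert _ _)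
  have hsN (i) : D k R (s i) ∈ N := Submodule.subset_span (Set.mem_insert_of_mem _ ⟨i, rfl⟩)
  refine Submodule.le_of_le_smul_of_le_jacobson_bot (I := maximalIdeal R) Module.Finite.fg_top
    (maximalIdeal_le_jacobson ⊥) ?_
  have hmD {a : R} (ha : a ∈ maximalIdeal R) : D k R a ∈ N ⊔ maximalIdeal R • ⊤ := by
    rw [ht, Ideal.mem_span_singleton'] at ha
    obtain ⟨b, rfl⟩ := ha
    rw [Derivation.leibniz]
    exact add_mem (Submodule.mem_sup_left (N.smul_mem _ htN)) (Submodule.mem_sup_right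
      (Submodule.smul_mem_smul (ht ▸ Ideal.mem_span_singleton_self t) trivial))
  have hsurj : Function.Surjective (algebraMap R (ResidueField R)) := residue_surjective
  -- every form agrees with an element of `N` after restriction to the residue field
  have hmap (x : Ω[R⁄k]) :
      ∃ y ∈ N, map k k R (ResidueField R) y = map k k R (ResidueField R) x := by
    have hx : map k k R (ResidueField R) x ∈ Submodule.span (ResidueField R)
      (Set.range fun i ↦ D k (ResidueField R) (residue R (s i))) := hs trivial
    obtain ⟨c, hc⟩ := Finsupp.mem_span_range_iff_exists_finsupp.mp hx
    choose c' hc' using fun i ↦ hsurj (c i)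
    refine ⟨∑ i ∈ c.support, c' i • D k R (s i),
      sum_mem fun i _ ↦ N.smul_mem _ (hsN i), ?_⟩
    simp only [map_sum, LinearMap.map_smul, map_D, ← hc, Finsupp.sum, ← hc',
      algebraMap_smul]
    rfl
  intro x _
  obtain ⟨y, hy, hxy⟩ := hmap x
  -- the conormal sequence: `x - y` differs from some `dm`, `m` in the maximal ideal, by an element
  -- of `𝔪 Ω`
  have h0 : mapBaseChange k R (ResidueField R) (1 ⊗ₜ (x - y)) = 0 := by
    simp [hxy]
  obtain ⟨m, hm⟩ := (exact_kerCotangentToTensor_mapBaseChange k R (ResidueField R) hsurj _).mp h0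
  obtain ⟨m, rfl⟩ := Ideal.toCotangent_surjective _ m
  rw [kerCotangentToTensor_toCotangent] at hm
  have hker : (x - y) - D k R m ∈ maximalIdeal R • (⊤ : Submodule R Ω[R⁄k]) := by
    rw [← LinearMap.ker_tensorProductMk, LinearMap.mem_ker, map_sub, sub_eq_zero]
    exact hm.symm
  have hm' : (m : R) ∈ maximalIdeal R := by
    simpa [RingHom.mem_ker] using m.2
  have := add_mem (add_mem (Submodule.mem_sup_right (S := N) hker) (hmD hm'))
    (Submodule.mem_sup_left hy)
  simpa using this

/-- A nonzero non-unit `t` is transcendental over elements `sᵢ` with algebraically independent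
residues: an algebraic relation would make some nonzero polynomial in the `sᵢ` divisible by `t`,
hence vanish in the residue field. -/
lemma algebraicIndependent_option_of_residueField {k R ι : Type*} [Field k] [CommRing R]
    [IsDomain R] [IsLocalRing R] [Algebra k R] {t : R}
    (ht : t ∈ maximalIdeal R) (ht0 : t ≠ 0) {s : ι → R}
    (hs : AlgebraicIndependent k fun i ↦ residue R (s i)) :
    AlgebraicIndependent k fun o : Option ι ↦ o.elim t s := by
  have hs' : AlgebraicIndependent k s :=
    AlgebraicIndependent.of_comp (IsScalarTower.toAlgHom k R (ResidueField R)) hs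
  rw [hs'.option_iff_transcendental]
  intro halg
  obtain ⟨⟨r, hr⟩, hr0, hdvd⟩ := halg.exists_nonzero_dvd (mem_nonZeroDivisors_of_ne_zero ht0)
  rw [Algebra.adjoin_range_eq_range_aeval] at hr
  obtain ⟨p, rfl⟩ := hr
  have hmem : MvPolynomial.aeval s p ∈ maximalIdeal R := Ideal.mem_of_dvd _ hdvd ht
  refine hr0 (Subtype.ext ?_)
  have h0 : MvPolynomial.aeval (fun i ↦ residue R (s i)) p = 0 := by
    have := MvPolynomial.comp_aeval_apply s (IsScalarTower.toAlgHom k R (ResidueField R)) p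
    exact this.symm.trans ((residue_eq_zero_iff _).mpr hmem)
  have := hs.eq_zero_of_aeval_eq_zero p h0
  simp [this]

lemma span_map_kaehlerDifferential_eq_top {k R K ι : Type*} [Field k] [CommRing R]
    [Algebra k R] [Field K] [Algebra R K] [Algebra k K] [IsScalarTower k R K]
    [IsFractionRing R K] {s : ι → R}
    (hs : ⊤ ≤ Submodule.span R (Set.range fun i ↦ D k R (s i))) :
    ⊤ ≤ Submodule.span K (Set.range fun i ↦ D k K (algebraMap R K (s i))) := by
  have := span_eq_top_of_isLocalizedModule K (nonZeroDivisors R) (map k k R K)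
    (v := Set.range fun i ↦ D k R (s i)) (top_le_iff.mp hs)
  rw [← this, ← Set.range_comp]
  exact le_of_eq (by congr; ext; simp)

lemma linearIndependent_D_of_span_eq_top {k R K ι : Type*} [Field k] [CommRing R] [IsDomain R]
    [Algebra k R] [Field K] [Algebra R K] [Algebra k K] [IsScalarTower k R K]
    [IsFractionRing R K] [Fintype ι] (hn : Module.finrank K Ω[K⁄k] = Fintype.card ι) {s : ι → R}
    (hs : ⊤ ≤ Submodule.span R (Set.range fun i ↦ D k R (s i))) :
    LinearIndependent R fun i ↦ D k R (s i) := by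
  have h1 := linearIndependent_of_top_le_span_of_card_eq_finrank
    (span_map_kaehlerDifferential_eq_top (K := K) hs) hn.symm
  have h2 : LinearIndependent R (map k k R K ∘ fun i ↦ D k R (s i)) := by
    convert! h1.restrict_scalars' R using 1
    ext; simp
  exact h2.of_comp

/-- In a discrete valuation ring essentially of finite type over a field of characteristic zero, a
uniformizer together with lifts of a transcendence basis of the residue field gives
coordinates. -/
theorem span_D_cons_eq_top_of_isTranscendenceBasis {k R : Type} {d : ℕ} [Field k] [CharZero k]
    [CommRing R] [IsDomain R] [IsLocalRing R] [Algebra k R] [Algebra.EssFiniteType k R]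
    {t : R} (ht : maximalIdeal R = Ideal.span {t}) {s : Fin d → R}
    (hs : IsTranscendenceBasis k fun i ↦ residue R (s i)) :
    ⊤ ≤ Submodule.span R (Set.range fun i ↦ D k R ((Fin.cons t s : Fin (d + 1) → R) i)) := by
  obtain ⟨b, hb⟩ := exists_basis_D_of_isTranscendenceBasis hs
  have := span_D_eq_top_of_residueField (k := k) ht (s := s) (by
    rw [← b.span_eq]
    exact le_of_eq (by congr; ext; simp [hb]))
  convert! this
  ext x
  simp [Fin.exists_fin_succ, eq_comm]

/-- The transcendence degree drops by exactly one on passing to the residue field of a discrete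
valuation ring essentially of finite type: the bound from above comes from the generators of
`Ω[R⁄k]`, the one from below from algebraic independence. -/
theorem finrank_eq_of_isTranscendenceBasis_residueField {k R K : Type} {d : ℕ} [Field k]
    [CharZero k] [CommRing R] [IsDomain R] [IsLocalRing R] [Algebra k R] [Algebra.EssFiniteType k R]
    [Field K] [Algebra R K] [Algebra k K] [IsScalarTower k R K] [IsFractionRing R K]
    {t : R} (ht : maximalIdeal R = Ideal.span {t}) (ht0 : t ≠ 0) {s : Fin d → R}
    (hs : IsTranscendenceBasis k fun i ↦ residue R (s i)) :
    Module.finrank K Ω[K⁄k] = d + 1 := by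
  refine le_antisymm ?_ ?_
  · have h := span_map_kaehlerDifferential_eq_top (K := K)
      (span_D_cons_eq_top_of_isTranscendenceBasis ht hs)
    have := finrank_range_le_card (R := K) fun i ↦
      D k K (algebraMap R K ((Fin.cons t s : Fin (d + 1) → R) i))
    rw [Set.finrank, top_le_iff.mp h] at this
    simpa using this
  · have h := (algebraicIndependent_option_of_residueField
      (ht ▸ Ideal.mem_span_singleton_self t) ht0 hs.1).map'
        (f := IsScalarTower.toAlgHom k R K) (IsFractionRing.injective R K)
    have : Algebra.EssFiniteType R K := .of_isLocalization K (nonZeroDivisors R)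
    have : Algebra.EssFiniteType k K := .comp k R K
    rw [finrank_kaehlerDifferential]
    simpa using Cardinal.toNat_le_toNat h.cardinalMk_le_trdeg (trdeg_lt_aleph0 k K)
end Kaehler

/-! ### Normal domains and primes of height one -/

section Hartogs

/-- A Noetherian normal domain is the intersection of its localizations at primes of height one.
The inclusion `φ ∈ R_p` is expressed by a denominator of `φ` outside `p`. -/
theorem exists_algebraMap_eq_of_forall_height_eq_one {R K : Type*} [CommRing R] [IsDomain R]
    [IsNoetherianRing R] [IsIntegrallyClosed R] [Field K] [Algebra R K] [IsFractionRing R K]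
    (φ : K) (h : ∀ p : Ideal R, p.IsPrime → p.height = 1 →
      ∃ a, ∃ s ∉ p, algebraMap R K s * φ = algebraMap R K a) :
    ∃ a, algebraMap R K a = φ := by
  obtain ⟨a, b, hb, rfl⟩ := IsFractionRing.div_surjective (A := R) φ
  have hinj := IsFractionRing.injective R K
  have hb0 : b ≠ 0 := nonZeroDivisors.ne_zero hb
  have hbK : algebraMap R K b ≠ 0 := by simpa using hb0
  by_contra hcon
  have hab : ¬ b ∣ a := by
    rintro ⟨c, rfl⟩
    exact hcon ⟨c, by rw [map_mul]; field_simp⟩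
  have hne : Submodule.Quotient.mk (p := Ideal.span {b}) a ≠ 0 := by
    rwa [Ne, Submodule.Quotient.mk_eq_zero, Ideal.mem_span_singleton]
  -- an associated prime `p` of the submodule of `R / b` generated by the class of `a`
  obtain ⟨p, hp, -⟩ := exists_le_isAssociatedPrime_of_isNoetherianRing R
    (M := Submodule.span R {Submodule.Quotient.mk (p := Ideal.span {b}) a})
    ⟨_, Submodule.mem_span_singleton_self _⟩ (fun h0 ↦ hne congr($h0.1))
  obtain ⟨hp, c, hc⟩ := isAssociatedPrime_iff.mp hp
  obtain ⟨r, hr⟩ := Submodule.mem_span_singleton.mp c.2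
  -- `p` consists of the denominators of `r a / b`
  have hmem (x : R) : x ∈ p ↔ b ∣ x * (r * a) := by
    rw [hc, Submodule.mem_colon_singleton, Submodule.mem_bot, Subtype.ext_iff, Submodule.coe_smul,
      ← hr, ← Submodule.Quotient.mk_smul, ← Submodule.Quotient.mk_smul, Submodule.coe_zero,
      Submodule.Quotient.mk_eq_zero,
      Ideal.mem_span_singleton, smul_eq_mul, smul_eq_mul]
  have hbp : b ∈ p := (hmem b).mpr (dvd_mul_right _ _)
  have h1 : (1 : R) ∉ p := p.ne_top_iff_one.mp hp.ne_top
  obtain ⟨x, hx, y, hy, hxy⟩ : ∃ x ∈ p, ∃ y ∉ p, x * (r * a) = b * y := by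
    by_contra! hall
    refine h1 ((hmem 1).mpr ?_)
    -- otherwise `r a / b` maps `p` into itself, hence is integral
    have hint : IsIntegral R (algebraMap R K (r * a) / algebraMap R K b) := by
      refine isIntegral_of_smul_mem_submodule (Submodule.map (Algebra.linearMap R K) p) ?_
        ((IsNoetherian.noetherian p).map _) _ ?_
      · rw [Submodule.ne_bot_iff]
        exact ⟨_, Submodule.mem_map_of_mem hbp, hbK⟩
      · rintro _ ⟨x, hx, rfl⟩
        obtain ⟨y, hy⟩ := (hmem x).mp hx
        refine ⟨y, by_contra fun hyp ↦ hall x hx y hyp hy, ?_⟩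
        have := congrArg (algebraMap R K) hy
        simp only [map_mul, Algebra.linearMap_apply, smul_eq_mul] at this ⊢
        field_simp
        linear_combination -this
    obtain ⟨y, hy⟩ := IsIntegrallyClosed.isIntegral_iff.mp hint
    refine ⟨y, hinj ?_⟩
    rw [eq_div_iff hbK] at hy
    rw [one_mul, map_mul _ b, ← hy, mul_comm]
  -- `p` is the annihilator of `y` modulo `x`, hence minimal over `x`
  have hmin : p ∈ (Ideal.span {x}).minimalPrimes := by
    refine ⟨⟨hp, by simpa⟩, fun q ⟨hq, hxq⟩ hqp z hz ↦ ?_⟩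
    obtain ⟨w, hw⟩ := (hmem z).mp hz
    have : y * z = w * x := mul_left_cancel₀ hb0 (by linear_combination -z * hxy + x * hw)
    have hyz := this ▸ q.mul_mem_left w (hxq (Ideal.mem_span_singleton_self x))
    exact (hq.mem_or_mem hyz).resolve_left fun hyq ↦ hy (hqp hyq)
  have hheight : p.height = 1 := le_antisymm
    (Ideal.height_le_one_of_isPrincipal_of_mem_minimalPrimes _ p hmin)
    (one_le_iff_ne_zero.mpr fun h0 ↦ hb0 (by
      rwa [Ideal.height_eq_zero_iff_eq_bot.mp h0] at hbp))
  obtain ⟨a', s, hs, hsa⟩ := h p hp hheight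
  refine hs ((hmem s).mpr ⟨r * a', hinj ?_⟩)
  rw [mul_div_assoc', div_eq_iff hbK] at hsa
  simp only [map_mul] at hsa ⊢
  linear_combination algebraMap R K r * hsa

end Hartogs

/-! ### Forms of top degree -/

section Forms

lemma alternatingMap_sum_smul {K V W : Type*} [CommRing K] [AddCommGroup V] [Module K V]
    [AddCommGroup W] [Module K W] {n : ℕ} (f : V [⋀^Fin n]→ₗ[K] W) (v : Fin n → V)
    (M : Matrix (Fin n) (Fin n) K) :
    f (fun j ↦ ∑ i, M i j • v i) = M.det • f v := by
  let g := f.compLinearMap (Fintype.linearCombination K v)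
  have hg : g = (LinearMap.toSpanSingleton K W (f v)).compAlternatingMap
      Matrix.detRowAlternating := by
    refine Module.Basis.ext_alternating (Pi.basisFun K (Fin n)) fun w hw ↦ ?_
    obtain ⟨σ, rfl⟩ : ∃ σ : Equiv.Perm (Fin n), w = σ :=
      ⟨Equiv.ofBijective w (Finite.injective_iff_bijective.mp hw), rfl⟩
    have h1 : Matrix.detRowAlternating (fun i ↦ Pi.basisFun K (Fin n) (σ i)) =
        (Equiv.Perm.sign σ : K) := by
      have := Matrix.det_permute σ (1 : Matrix (Fin n) (Fin n) K)
      rw [Matrix.det_one, mul_one] at this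
      rw [← this]
      refine congrArg _ (funext₂ fun i j ↦ ?_)
      simp [Matrix.one_apply, Pi.single_apply, eq_comm]
    rw [LinearMap.compAlternatingMap_apply, h1]
    have h2 : g (fun i ↦ Pi.basisFun K (Fin n) (σ i)) = f (v ∘ σ) := by
      simp [g, Fintype.linearCombination_apply_single, Function.comp_def]
    rw [h2, AlternatingMap.map_perm]
    simp [Units.smul_def, Int.cast_smul_eq_zsmul]
  have := congr($hg fun j i ↦ M i j)
  rw [← M.det_transpose]
  simp only [g, AlternatingMap.compLinearMap_apply, Fintype.linearCombination_apply] at this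
  exact this

open KaehlerDifferential IsLocalRing

/-- The change of variables formula for forms of top degree, with a transition matrix over `R`. -/
lemma dWedge_eq_det_smul {R K : Type} {n : ℕ} [CommRing R] [Algebra ℂ R] [CommRing K] [Algebra R K]
    [Algebra ℂ K] [IsScalarTower ℂ R K] {s t : Fin n → R} {M : Matrix (Fin n) (Fin n) R}
    (h : ∀ j, D ℂ R (s j) = ∑ i, M i j • D ℂ R (t i)) :
    dWedge (fun i ↦ algebraMap R K (s i)) =
      algebraMap R K M.det • dWedge fun i ↦ algebraMap R K (t i) := by
  rw [RingHom.map_det, dWedge, dWedge, ← alternatingMap_sum_smul]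
  congr 1
  ext j
  have := congrArg (map ℂ ℂ R K) (h j)
  simpa only [map_sum, LinearMap.map_smul, map_D, RingHom.mapMatrix_apply, Matrix.map_apply,
    algebraMap_smul] using this

lemma exists_matrix_D_eq {R : Type} {n : ℕ} [CommRing R] [Algebra ℂ R] {t : Fin n → R}
    (ht : ⊤ ≤ Submodule.span R (Set.range fun i ↦ D ℂ R (t i))) (s : Fin n → R) :
    ∃ M : Matrix (Fin n) (Fin n) R, ∀ j, D ℂ R (s j) = ∑ i, M i j • D ℂ R (t i) := by
  choose c hc using fun j ↦ (Submodule.mem_span_range_iff_exists_fun R).mp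
    (ht (x := D ℂ R (s j)) trivial)
  exact ⟨fun i j ↦ c j i, fun j ↦ (hc j).symm⟩

lemma dWedge_ne_zero {K : Type} {n : ℕ} [Field K] [Algebra ℂ K] {s : Fin n → K}
    (h : LinearIndependent K fun i ↦ D ℂ K (s i))
    (h' : ⊤ ≤ Submodule.span K (Set.range fun i ↦ D ℂ K (s i))) : dWedge s ≠ 0 := by
  let b := Module.Basis.mk h h'
  intro h0
  have h1 := congrArg (exteriorPower.alternatingMapLinearEquiv b.det) h0
  rw [dWedge, exteriorPower.alternatingMapLinearEquiv_apply_ιMulti, map_zero] at h1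
  have h2 : (fun i ↦ D ℂ K (s i)) = b := by simp [b]
  rw [h2, b.det_self] at h1
  exact one_ne_zero h1

lemma exists_smul_dWedge_eq {K : Type} {n : ℕ} [Field K] [Algebra ℂ K] {s : Fin n → K}
    (h' : ⊤ ≤ Submodule.span K (Set.range fun i ↦ D ℂ K (s i))) (ω : Forms n K) :
    ∃ a : K, ω = a • dWedge s := by
  have hω : ω ∈ Submodule.span K (Set.range (exteriorPower.ιMulti K n (M := Ω[K⁄ℂ]))) := by
    rw [exteriorPower.ιMulti_span]; trivial
  induction hω using Submodule.span_induction with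
  | mem x hx =>
    obtain ⟨v, rfl⟩ := hx
    choose c hc using fun j ↦ (Submodule.mem_span_range_iff_exists_fun K).mp (h' (x := v j) trivial)
    refine ⟨(Matrix.of fun i j ↦ c j i).det, ?_⟩
    rw [dWedge, ← alternatingMap_sum_smul]
    exact congrArg _ (funext fun j ↦ (hc j).symm)
  | zero => exact ⟨0, by simp⟩
  | add x y _ _ hx hy =>
    obtain ⟨a, rfl⟩ := hx
    obtain ⟨b, rfl⟩ := hy
    exact ⟨a + b, (add_smul ..).symm⟩
  | smul c x _ hx =>
    obtain ⟨a, rfl⟩ := hx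
    exact ⟨c * a, (mul_smul ..).symm⟩

/-- The forms of two systems of coordinates over `R` differ by a unit of `R`, since the
determinants of the two transition matrices are inverse to each other. -/
lemma dWedge_eq_isUnit_smul {R K : Type} {n : ℕ} [CommRing R] [IsDomain R] [Algebra ℂ R] [Field K]
    [Algebra R K] [Algebra ℂ K] [IsScalarTower ℂ R K] [FaithfulSMul R K] {s t : Fin n → R}
    (hs : ⊤ ≤ Submodule.span R (Set.range fun i ↦ D ℂ R (s i)))
    (ht : ⊤ ≤ Submodule.span R (Set.range fun i ↦ D ℂ R (t i)))
    (hs0 : dWedge (fun i ↦ algebraMap R K (s i)) ≠ 0) :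
    ∃ w : R, IsUnit w ∧ dWedge (fun i ↦ algebraMap R K (s i)) =
      algebraMap R K w • dWedge fun i ↦ algebraMap R K (t i) := by
  obtain ⟨M, hM⟩ := exists_matrix_D_eq ht s
  obtain ⟨N, hN⟩ := exists_matrix_D_eq hs t
  have h1 := dWedge_eq_det_smul (K := K) hM
  refine ⟨M.det, ?_, h1⟩
  have h2 := dWedge_eq_det_smul (K := K) hN
  rw [h2, smul_smul, ← map_mul] at h1
  refine IsUnit.of_mul_eq_one N.det (FaithfulSMul.algebraMap_injective R K ?_)
  rw [map_one, ← sub_eq_zero]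
  refine (smul_eq_zero.mp (?_ : _ • dWedge (fun i ↦ algebraMap R K (s i)) = 0)).resolve_right hs0
  rw [sub_smul, one_smul, ← h1, sub_self]

/-- The computation behind the ramification formula: if `(t, s)` are coordinates, then
`d(u tʳ) ∧ ds = tʳ⁻¹ w dt ∧ ds` with `w = r u + t ∂u/∂t`, which is a unit in characteristic
zero. -/
theorem dWedge_cons_unit_mul_pow {R K : Type} {d r : ℕ} (hr : 0 < r) [CommRing R] [IsLocalRing R]
    [Algebra ℂ R] [CommRing K] [Algebra R K] [Algebra ℂ K] [IsScalarTower ℂ R K]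
    {t : R} (htm : t ∈ maximalIdeal R) {s : Fin d → R}
    (ht : ⊤ ≤ Submodule.span R (Set.range fun i ↦ D ℂ R ((Fin.cons t s : Fin (d + 1) → R) i)))
    {u : R} (hu : IsUnit u) :
    ∃ w : R, IsUnit w ∧
      dWedge (fun i ↦ algebraMap R K ((Fin.cons (u * t ^ r) s : Fin (d + 1) → R) i)) =
      algebraMap R K (t ^ (r - 1) * w) •
        dWedge fun i ↦ algebraMap R K ((Fin.cons t s : Fin (d + 1) → R) i) := by
  obtain ⟨c, hc⟩ := (Submodule.mem_span_range_iff_exists_fun R).mp (ht (x := D ℂ R u) trivial)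
  -- the coefficients of `d(u tʳ) = tʳ du + r u tʳ⁻¹ dt`
  let v : Fin (d + 1) → R := t ^ r • c + Pi.single 0 (t ^ (r - 1) * (r * u))
  refine ⟨r * u + t * c 0, ?_, ?_⟩
  · rw [← notMem_maximalIdeal]
    intro hmem
    refine (notMem_maximalIdeal.mpr ((?_ : IsUnit (r : R)).mul hu))
      ((Ideal.add_mem_iff_left _ (Ideal.mul_mem_right _ _ htm)).mp hmem)
    have := (IsUnit.mk0 (r : ℂ) (by exact_mod_cast hr.ne')).map (algebraMap ℂ R)
    simpa using this
  · rw [dWedge_eq_det_smul (M := (1 : Matrix _ _ R).updateCol 0 v)]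
    · rw [← Matrix.cramer_apply, Matrix.cramer_one]
      congr 2
      obtain ⟨q, rfl⟩ : ∃ q, r = q + 1 := ⟨r - 1, by omega⟩
      simp [v]
      ring
    · intro j
      refine Fin.cases ?_ (fun j ↦ ?_) j
      · simp [v, Matrix.updateCol_self, add_smul, Finset.sum_add_distrib, Pi.single_apply, mul_smul,
          ← Finset.smul_sum, hc, Derivation.leibniz, Derivation.leibniz_pow]
        module
      · simp [Matrix.updateCol_ne, Matrix.one_apply, Fin.succ_ne_zero]
end Forms

/-! ### Spreading out coordinates -/

section Spreading
open KaehlerDifferential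

/-- Spreading out: if the differentials of the `sᵢ ∈ A` span after localization at `M`, then they
span after inverting a single element `f` of `M`. -/
lemma exists_smul_mem_span_D {k A R ι : Type*} [CommRing k] [CommRing A] [Algebra k A]
    [Algebra.FiniteType k A] [CommRing R] [Algebra A R] [Algebra k R] [IsScalarTower k A R]
    (M : Submonoid A) [IsLocalization M R] {s : ι → A}
    (hs : ⊤ ≤ Submodule.span R (Set.range fun i ↦ D k R (algebraMap A R (s i)))) :
    ∃ f ∈ M, ∀ ω : Ω[A⁄k], f • ω ∈ Submodule.span A (Set.range fun i ↦ D k A (s i)) := by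
  set N := Submodule.span A (Set.range fun i ↦ D k A (s i))
  have key (x : Ω[R⁄k]) : ∃ m ∈ M, ∃ n ∈ N, m • x = map k k A R n := by
    induction hs (x := x) trivial using Submodule.span_induction with
    | mem x hx =>
      obtain ⟨i, rfl⟩ := hx
      exact ⟨1, M.one_mem, _, Submodule.subset_span ⟨i, rfl⟩, by simp⟩
    | zero => exact ⟨1, M.one_mem, 0, N.zero_mem, by simp⟩
    | add x y _ _ hx hy =>
      obtain ⟨m, hm, n, hn, hx⟩ := hx
      obtain ⟨m', hm', n', hn', hy⟩ := hy
      refine ⟨m * m', mul_mem hm hm', _, N.add_mem (N.smul_mem m' hn) (N.smul_mem m hn'), ?_⟩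
      rw [map_add, LinearMap.map_smul, LinearMap.map_smul, ← hx, ← hy]
      module
    | smul c x _ hx =>
      obtain ⟨m, hm, n, hn, hx⟩ := hx
      obtain ⟨a, b, rfl⟩ := IsLocalization.exists_mk'_eq M c
      refine ⟨m * b, mul_mem hm b.2, _, N.smul_mem a hn, ?_⟩
      rw [LinearMap.map_smul, ← hx, mul_smul, ← smul_assoc (b : A), Algebra.smul_def (b : A),
        IsLocalization.mk'_spec', algebraMap_smul, smul_comm]
  have key' (ω : Ω[A⁄k]) : ∃ m ∈ M, m • ω ∈ N := by
    obtain ⟨m, hm, n, hn, h⟩ := key (map k k A R ω)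
    obtain ⟨c, hc⟩ := IsLocalizedModule.exists_of_eq (S := M) (f := map k k A R)
      (x₁ := m • ω) (x₂ := n) (by rw [LinearMap.map_smul, ← h])
    exact ⟨c * m, mul_mem c.2 hm, by rw [mul_smul]; exact hc ▸ N.smul_mem _ hn⟩
  obtain ⟨S, hS⟩ := (Module.Finite.fg_top : (⊤ : Submodule A Ω[A⁄k]).FG)
  choose m hm hmN using key'
  refine ⟨∏ ω ∈ S, m ω, prod_mem fun ω _ ↦ hm ω, fun ω ↦ ?_⟩
  induction hS.ge (x := ω) trivial using Submodule.span_induction with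
  | mem x hx =>
    classical
    rw [← Finset.prod_erase_mul _ _ hx, mul_smul]
    exact N.smul_mem _ (hmN x)
  | zero => simp
  | add x y _ _ hx hy => rw [smul_add]; exact N.add_mem hx hy
  | smul c x _ hx => rw [smul_comm]; exact N.smul_mem _ hx

/-- The converse direction of `exists_smul_mem_span_D`, for any localization in which `f` is
invertible. -/
lemma span_D_eq_top_of_smul_mem {k A R ι : Type*} [CommRing k] [CommRing A] [Algebra k A]
    [CommRing R] [Algebra A R] [Algebra k R] [IsScalarTower k A R]
    (M : Submonoid A) [IsLocalization M R] {s : ι → A} {f : A} (hf : IsUnit (algebraMap A R f))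
    (h : ∀ ω : Ω[A⁄k], f • ω ∈ Submodule.span A (Set.range fun i ↦ D k A (s i))) :
    ⊤ ≤ Submodule.span R (Set.range fun i ↦ D k R (algebraMap A R (s i))) := by
  rw [← span_range_map_derivation_of_isLocalization k A R M, Submodule.span_le]
  rintro _ ⟨a, rfl⟩
  obtain ⟨u, hu⟩ := hf
  have h1 : (u : R) • map k k A R (D k A a) ∈
      Submodule.span R (Set.range fun i ↦ D k R (algebraMap A R (s i))) := by
    rw [hu, algebraMap_smul, ← LinearMap.map_smul]
    have h' := h (D k A a)
    generalize f • D k A a = ω at h'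
    induction h' using Submodule.span_induction with
    | mem x hx =>
      obtain ⟨i, rfl⟩ := hx
      exact Submodule.subset_span ⟨i, by simp⟩
    | zero => simp
    | add x y _ _ hx hy => rw [map_add]; exact add_mem hx hy
    | smul c x _ hx =>
      rw [LinearMap.map_smul, ← algebraMap_smul R]
      exact Submodule.smul_mem _ _ hx
  simpa [smul_smul] using Submodule.smul_mem _ (↑u⁻¹ : R) h1

end Spreading

/-! ### Local rings of varieties as `ℂ`-algebras -/

section Stalks

variable (X : Scheme.{0}) [X.Over SpecC]

/-- The scalars `ℂ → 𝒪_X(U)`. -/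
def scalarsToSections (U : X.Opens) : CommRingCat.of ℂ ⟶ Γ(X, U) :=
  (Scheme.ΓSpecIso (CommRingCat.of ℂ)).inv ≫ (X ↘ SpecC).appTop ≫ X.presheaf.map (homOfLE le_top).op

instance sectionsAlgebra (U : X.Opens) : Algebra ℂ Γ(X, U) :=
  (scalarsToSections X U).hom.toAlgebra

lemma scalarsToSections_germ (U : X.Opens) (x : X) (hx : x ∈ U) :
    scalarsToSections X U ≫ X.presheaf.germ U x hx = scalarsToStalk X x := by
  simp only [scalarsToSections, scalarsToStalk, Category.assoc]
  congr 2
  exact X.presheaf.germ_res _ _ _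

instance isScalarTower_sections_stalk (U : X.Opens) (x : U) :
    IsScalarTower ℂ Γ(X, U) (X.presheaf.stalk (x : X)) :=
  .of_algebraMap_eq fun r ↦ congr($(scalarsToSections_germ X U x x.2).hom r).symm

instance isScalarTower_stalk_functionField [IsIntegral X] (x : X) :
    IsScalarTower ℂ (X.presheaf.stalk x) X.functionField :=
  .of_algebraMap_eq fun r ↦ by
    have : scalarsToStalk X x ≫
        X.presheaf.stalkSpecializes ((genericPoint_spec X).specializes trivial) =
        scalarsToStalk X (genericPoint X) := by
      simp only [scalarsToStalk, Category.assoc]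
      rw [TopCat.Presheaf.germ_stalkSpecializes]
    exact congr($(this).hom r).symm

variable {X}
lemma finiteType_sections [IsVariety X] {U : X.Opens} (hU : IsAffineOpen U) :
    Algebra.FiniteType ℂ Γ(X, U) := by
  have := IsVariety.locallyOfFiniteType (X := X)
  have h := HasRingHomProperty.appLE @LocallyOfFiniteType (X ↘ SpecC) this
    ⟨⊤, isAffineOpen_top SpecC⟩ ⟨U, hU⟩ le_top
  have h' : (scalarsToSections X U).hom.FiniteType := by
    convert! h.comp (RingHom.FiniteType.of_surjective
      (Scheme.ΓSpecIso (CommRingCat.of ℂ)).inv.hom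
      (ConcreteCategory.bijective_of_isIso (Scheme.ΓSpecIso (CommRingCat.of ℂ)).inv).2)
  exact h'

instance [IsVariety X] (x : X) : Algebra.EssFiniteType ℂ (X.presheaf.stalk x) := by
  obtain ⟨_, ⟨U, hU, rfl⟩, hxU, -⟩ :=
    X.isBasis_affineOpens.exists_subset_of_mem_open (Set.mem_univ x) isOpen_univ
  suffices h : ∀ x : U, Algebra.EssFiniteType ℂ (X.presheaf.stalk (x : X)) from h ⟨x, hxU⟩
  intro x
  have := finiteType_sections hU
  have := hU.isLocalization_stalk x
  have : Algebra.EssFiniteType Γ(X, U) (X.presheaf.stalk (x : X)) :=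
    .of_isLocalization _ (hU.primeIdealOf x).asIdeal.primeCompl
  exact .comp ℂ Γ(X, U) _

lemma finrank_functionField [IsVariety X] :
    Module.finrank X.functionField Ω[X.functionField⁄ℂ] = dim X :=
  finrank_kaehlerDifferential

/-- On a variety, `dim X` functions whose differentials span are local coordinates: linear
independence is automatic because `Ω` has rank `dim X` over the function field. -/
lemma isLocalCoords_iff [IsVariety X] {x : X} {t : Fin (dim X) → X.presheaf.stalk x} :
    IsLocalCoords x t ↔ ⊤ ≤ Submodule.span (X.presheaf.stalk x)
      (Set.range fun i ↦ KaehlerDifferential.D ℂ (X.presheaf.stalk x) (t i)) :=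
  ⟨fun h ↦ h.2.ge, fun h ↦ ⟨linearIndependent_D_of_span_eq_top (K := X.functionField)
    (by rw [finrank_functionField, Fintype.card_fin]) h, top_le_iff.mp h⟩⟩

end Stalks

/-! ### Coordinates near a point -/

section Coords
variable {X : Scheme.{0}} [X.Over SpecC] [IsVariety X]

open KaehlerDifferential in
/-- Functions whose differentials span at `y` have this property at all points of a neighbourhood
of `y`. -/
lemma exists_coords_nhds {n : ℕ} {y : X} {s : Fin n → X.presheaf.stalk y}
    (hs : ⊤ ≤ Submodule.span (X.presheaf.stalk y)
      (Set.range fun i ↦ D ℂ (X.presheaf.stalk y) (s i))) :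
    ∃ U : X.Opens, y ∈ U ∧ ∀ z ∈ U, ∃ s' : Fin n → X.presheaf.stalk z,
      ⊤ ≤ Submodule.span (X.presheaf.stalk z)
        (Set.range fun i ↦ D ℂ (X.presheaf.stalk z) (s' i)) ∧
      ∀ i, algebraMap _ X.functionField (s' i) = algebraMap _ X.functionField (s i) := by
  choose W hW σ hσ using fun i ↦ X.presheaf.exists_germ_eq (s i)
  obtain ⟨_, ⟨V, hV, rfl⟩, hyV, hVW⟩ := X.isBasis_affineOpens.exists_subset_of_mem_open
    (a := y) (u := ⋂ i, W i) (by simpa using hW) (isOpen_iInter_of_finite fun i ↦ (W i).isOpen)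
  have hle (i) : V ≤ W i := hVW.trans (Set.iInter_subset _ i)
  let a (i) : Γ(X, V) := X.presheaf.map (homOfLE (hle i)).op (σ i)
  have ha (i) : X.presheaf.germ V y hyV (a i) = s i := by
    rw [← hσ i]
    exact X.presheaf.germ_res_apply (homOfLE (hle i)) y hyV (σ i)
  have : Nonempty V := ⟨⟨y, hyV⟩⟩
  have := finiteType_sections hV
  have hloc (z : V) := hV.isLocalization_stalk z
  let _ : Algebra Γ(X, V) (X.presheaf.stalk y) := X.presheaf.algebra_section_stalk ⟨y, hyV⟩
  have : IsScalarTower ℂ Γ(X, V) (X.presheaf.stalk y) :=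
    isScalarTower_sections_stalk X V ⟨y, hyV⟩
  have := hloc ⟨y, hyV⟩
  obtain ⟨f, hfM, hf⟩ := exists_smul_mem_span_D (R := X.presheaf.stalk y) (s := a) (k := ℂ)
    (hV.primeIdealOf ⟨y, hyV⟩).asIdeal.primeCompl (by
      convert! hs using 7 with i
      exact ha i)
  refine ⟨X.basicOpen f, (X.mem_basicOpen f y hyV).mpr
    (IsLocalization.map_units (X.presheaf.stalk y) (⟨f, hfM⟩ :
      (hV.primeIdealOf ⟨y, hyV⟩).asIdeal.primeCompl)), fun z hz ↦ ?_⟩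
  have hzV : z ∈ V := X.basicOpen_le f hz
  refine ⟨fun i ↦ X.presheaf.germ V z hzV (a i), ?_, fun i ↦ ?_⟩
  · let _ : Algebra Γ(X, V) (X.presheaf.stalk z) := X.presheaf.algebra_section_stalk ⟨z, hzV⟩
    have : IsScalarTower ℂ Γ(X, V) (X.presheaf.stalk z) :=
      isScalarTower_sections_stalk X V ⟨z, hzV⟩
    have := hloc ⟨z, hzV⟩
    exact span_D_eq_top_of_smul_mem (R := X.presheaf.stalk z) (A := Γ(X, V))
      (hV.primeIdealOf ⟨z, hzV⟩).asIdeal.primeCompl ((X.mem_basicOpen f z hzV).mp hz) hf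
  · rw [← ha i]
    simp only [Scheme.algebraMap_germ_eq_germToFunctionField]

end Coords

/-! ### Orders of vanishing on normal varieties -/

section Order

variable {X : Scheme.{0}} [X.Over SpecC] [IsVariety X]

lemma isDiscreteValuationRing_stalk [IsNormalScheme X] {x : X} (hx : coheight x = 1) :
    IsDiscreteValuationRing (X.presheaf.stalk x) := by
  have := IsNormalScheme.isIntegrallyClosed_stalk x
  have hdim : ringKrullDim (X.presheaf.stalk x) = 1 := by
    rw [ringKrullDim_stalk_eq_coheight, hx]; rfl
  have hnf : ¬ IsField (X.presheaf.stalk x) := fun h ↦ by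
    rw [ringKrullDim_eq_zero_of_isField h] at hdim
    exact zero_ne_one hdim
  have : Ring.KrullDimLE 1 (X.presheaf.stalk x) := krullDimLE_of_coheight_le hx.le
  have : Ring.DimensionLEOne (X.presheaf.stalk x) :=
    ⟨fun hp hprime ↦ Ring.krullDimLE_one_iff_of_isPrime_bot.mp this _ hp hprime⟩
  have : IsDedekindDomain (X.presheaf.stalk x) := { __ := this, __ := ‹IsIntegrallyClosed _› }
  exact ((IsDiscreteValuationRing.TFAE _ hnf).out 2 0).mp this

lemma ord_algebraMap_of_isUnit {x : X} {u : X.presheaf.stalk x} (hu : IsUnit u) :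
    Scheme.ord (algebraMap _ X.functionField u) x = 0 := by
  by_cases hx : coheight x = 1
  · have : Ring.KrullDimLE 1 (X.presheaf.stalk x) := krullDimLE_of_coheight_le hx.le
    rw [Scheme.ord_eq_iff hx (hu.map _).ne_zero]
    exact Ring.ordFrac_of_isUnit hu
  · exact Scheme.ord_eq_zero_of_coheight_neq_one hx _

lemma ord_algebraMap_of_irreducible [IsNormalScheme X] {x : X} (hx : coheight x = 1)
    {t : X.presheaf.stalk x} (ht : Irreducible t) :
    Scheme.ord (algebraMap _ X.functionField t) x = 1 := by
  have : Ring.KrullDimLE 1 (X.presheaf.stalk x) := krullDimLE_of_coheight_le hx.le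
  have := isDiscreteValuationRing_stalk hx
  rw [Scheme.ord_eq_iff hx (by simpa using ht.ne_zero)]
  refine (Ring.ordFrac_eq_ord _ ht.ne_zero).trans ?_
  rw [Ring.ordMonoidWithZeroHom_eq_coe _ (n := 1) (mem_nonZeroDivisors_of_ne_zero ht.ne_zero)
    (by simpa using Ring.ord_of_irreducible ht)]
  rfl

lemma ord_one (x : X) : Scheme.ord (1 : X.functionField) x = 0 := by
  simpa using ord_algebraMap_of_isUnit (x := x) isUnit_one

lemma ord_inv {x : X} {f : X.functionField} (hf : f ≠ 0) : Scheme.ord f⁻¹ x = - Scheme.ord f x := by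
  have := Scheme.ord_mul (x := x) hf (inv_ne_zero hf)
  rw [mul_inv_cancel₀ hf, ord_one] at this
  omega

lemma ord_div {x : X} {f g : X.functionField} (hf : f ≠ 0) (hg : g ≠ 0) :
    Scheme.ord (f / g) x = Scheme.ord f x - Scheme.ord g x := by
  rw [div_eq_mul_inv, Scheme.ord_mul hf (inv_ne_zero hg), ord_inv hg]; rfl

lemma ord_pow {x : X} {f : X.functionField} (hf : f ≠ 0) (n : ℕ) :
    Scheme.ord (f ^ n) x = n * Scheme.ord f x := by
  induction n with
  | zero => simp [ord_one]
  | succ n ih => rw [pow_succ, Scheme.ord_mul (pow_ne_zero _ hf) hf, ih]; push_cast; ring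

lemma exists_unit_mul_zpow [IsNormalScheme X] {x : X} (hx : coheight x = 1)
    {t : X.presheaf.stalk x} (ht : Irreducible t) {f : X.functionField} (hf : f ≠ 0) :
    ∃ u : X.presheaf.stalk x, IsUnit u ∧ f = algebraMap _ X.functionField u *
      algebraMap _ X.functionField t ^ (Scheme.ord f x) := by
  have := isDiscreteValuationRing_stalk hx
  have ht0 : algebraMap _ X.functionField t ≠ 0 := by simpa using ht.ne_zero
  obtain ⟨a, b, hb, hab⟩ := IsFractionRing.div_surjective (A := X.presheaf.stalk x) f
  have ha0 : a ≠ 0 := by rintro rfl; simp [← hab] at hf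
  obtain ⟨n, u, rfl⟩ := IsDiscreteValuationRing.eq_unit_mul_pow_irreducible ha0 ht
  obtain ⟨m, v, rfl⟩ :=
    IsDiscreteValuationRing.eq_unit_mul_pow_irreducible (nonZeroDivisors.ne_zero hb) ht
  have hv0 : algebraMap _ X.functionField (v : X.presheaf.stalk x) ≠ 0 := (v.isUnit.map _).ne_zero
  have hu0 : algebraMap _ X.functionField (u : X.presheaf.stalk x) ≠ 0 := (u.isUnit.map _).ne_zero
  have hvi : algebraMap _ X.functionField (↑v⁻¹ : X.presheaf.stalk x) =
      (algebraMap _ X.functionField (v : X.presheaf.stalk x))⁻¹ :=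
    eq_inv_of_mul_eq_one_left (by rw [← map_mul, Units.inv_mul, map_one])
  have hord : Scheme.ord f x = n - m := by
    rw [← hab, map_mul, map_mul, map_pow, map_pow,
      ord_div (mul_ne_zero hu0 (pow_ne_zero _ ht0)) (mul_ne_zero hv0 (pow_ne_zero _ ht0)),
      Scheme.ord_mul hu0 (pow_ne_zero _ ht0), Scheme.ord_mul hv0 (pow_ne_zero _ ht0),
      ord_pow ht0, ord_pow ht0, ord_algebraMap_of_isUnit u.isUnit,
      ord_algebraMap_of_isUnit v.isUnit, ord_algebraMap_of_irreducible hx ht]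
    ring
  refine ⟨↑(u * v⁻¹), (u * v⁻¹).isUnit, ?_⟩
  rw [hord, ← hab, zpow_sub₀ ht0, zpow_natCast, zpow_natCast, Units.val_mul]
  simp only [map_mul, map_pow, hvi]
  field_simp

end Order

/-! ### Orders of rational forms -/

section FormsOnVarieties
variable {X : Scheme.{0}} [X.Over SpecC] [IsVariety X]

lemma IsLocalCoords.functionField {n : ℕ} {x : X} {t : Fin n → X.presheaf.stalk x}
    (ht : IsLocalCoords x t) : ⊤ ≤ Submodule.span X.functionField (Set.range fun i ↦
      KaehlerDifferential.D ℂ X.functionField (algebraMap _ X.functionField (t i))) :=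
  span_map_kaehlerDifferential_eq_top ht.2.ge

lemma coordForm_ne_zero {x : X} {t : Fin (dim X) → X.presheaf.stalk x}
    (ht : IsLocalCoords x t) : coordForm t ≠ 0 :=
  dWedge_ne_zero (linearIndependent_of_top_le_span_of_card_eq_finrank ht.functionField
    (by rw [finrank_functionField, Fintype.card_fin])) ht.functionField

lemma exists_eq_smul_coordForm {n : ℕ} {x : X} {t : Fin n → X.presheaf.stalk x}
    (ht : IsLocalCoords x t) (ω : Forms n X.functionField) :
    ∃ a : X.functionField, ω = a • coordForm t :=
  exists_smul_dWedge_eq ht.functionField ω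

/-- The order of a form of top degree may be computed in any local coordinates. -/
lemma ordForm_of_eq_smul_coordForm {x : X} {t : Fin (dim X) → X.presheaf.stalk x}
    (ht : IsLocalCoords x t) {ω : Forms (dim X) X.functionField} {a : X.functionField}
    (hω : ω = a • coordForm t) : ordForm ω x = Scheme.ord a x := by
  have h : ∃ b : X.functionField, ∃ s : Fin (dim X) → X.presheaf.stalk x,
      IsLocalCoords x s ∧ ω = b • coordForm s := ⟨a, t, ht, hω⟩
  rw [ordForm, dif_pos h]
  obtain ⟨s, hs, hab⟩ := h.choose_spec
  obtain ⟨w, hw, hst⟩ := dWedge_eq_isUnit_smul (K := X.functionField) ht.2.ge hs.2.ge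
    (coordForm_ne_zero ht)
  change coordForm t = _ • coordForm s at hst
  generalize h.choose = b at hab ⊢
  rw [hω, hst, smul_smul] at hab
  have := smul_left_injective _ (coordForm_ne_zero hs) hab
  rw [← this]
  by_cases ha : a = 0
  · simp [ha]
  · rw [Scheme.ord_mul ha (hw.map _).ne_zero, ord_algebraMap_of_isUnit hw, add_zero]

open IsLocalRing in
/-- The residue field at a point of codimension one of a normal variety has transcendence degree
`dim X - 1`. -/
lemma exists_isTranscendenceBasis_residueField [IsNormalScheme X] {x : X} (hx : coheight x = 1) :
    ∃ d : ℕ, dim X = d + 1 ∧ Algebra.trdeg ℂ (ResidueField (X.presheaf.stalk x)) = d ∧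
      ∃ s : Fin d → X.presheaf.stalk x, IsTranscendenceBasis ℂ fun i ↦ residue _ (s i) := by
  have := isDiscreteValuationRing_stalk hx
  obtain ⟨t, ht⟩ := IsDiscreteValuationRing.exists_irreducible (X.presheaf.stalk x)
  have : Algebra.EssFiniteType ℂ (ResidueField (X.presheaf.stalk x)) :=
    .comp ℂ (X.presheaf.stalk x) _
  obtain ⟨S, hS⟩ := exists_finset_isTranscendenceBasis (K := ℂ)
    (L := ResidueField (X.presheaf.stalk x))
  have hS' := hS.comp_equiv S.equivFin.symm
  choose s hs using fun i ↦
    residue_surjective (R := X.presheaf.stalk x) (S.equivFin.symm i : ResidueField _)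
  have hs' : IsTranscendenceBasis ℂ fun i ↦ residue (X.presheaf.stalk x) (s i) := by
    convert! hS' using 1
    exact funext hs
  refine ⟨_, ?_, ?_, s, hs'⟩
  · rw [← finrank_functionField]
    exact finrank_eq_of_isTranscendenceBasis_residueField ht.maximalIdeal_eq ht.ne_zero hs'
  · rw [← hs'.cardinalMk_eq_trdeg]
    simp

/-- A normal variety is regular in codimension one. -/
lemma exists_isLocalCoords [IsNormalScheme X] {x : X} (hx : coheight x = 1) :
    ∃ t : Fin (dim X) → X.presheaf.stalk x, IsLocalCoords x t := by
  have := isDiscreteValuationRing_stalk hx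
  obtain ⟨t, ht⟩ := IsDiscreteValuationRing.exists_irreducible (X.presheaf.stalk x)
  obtain ⟨d, hd, -, s, hs⟩ := exists_isTranscendenceBasis_residueField hx
  rw [hd]
  have h1 := span_D_cons_eq_top_of_isTranscendenceBasis ht.maximalIdeal_eq hs
  refine ⟨_, linearIndependent_D_of_span_eq_top (K := X.functionField) ?_ h1, top_le_iff.mp h1⟩
  rw [finrank_functionField, Fintype.card_fin, hd]

lemma exists_isLocalCoords_genericPoint :
    ∃ t : Fin (dim X) → X.presheaf.stalk (genericPoint X), IsLocalCoords (genericPoint X) t := by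
  obtain ⟨S, hS⟩ := exists_finset_isTranscendenceBasis (K := ℂ) (L := X.functionField)
  have hS' := hS.comp_equiv S.equivFin.symm
  obtain ⟨b, hb⟩ := exists_basis_D_of_isTranscendenceBasis hS'
  have hc : S.card = dim X := by
    rw [← finrank_functionField, Module.finrank_eq_card_basis b, Fintype.card_fin]
  rw [← hc]
  refine ⟨fun i ↦ (S.equivFin.symm i : X.functionField), ?_, ?_⟩
  · convert! b.linearIndependent using 1
    exact (funext hb).symm
  · rw [← b.span_eq]
    congr 2
    exact (funext hb).symm

lemma canonicalForm_ne_zero : canonicalForm X ≠ 0 := by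
  obtain ⟨t, ht⟩ := exists_isLocalCoords_genericPoint (X := X)
  exact Classical.epsilon_spec (p := fun ω : Forms (dim X) X.functionField ↦ ω ≠ 0)
    ⟨_, coordForm_ne_zero ht⟩

end FormsOnVarieties

/-! ### Pull-back of forms -/

section PullForm
variable {n : ℕ} {K L F : Type} [Field K] [Field L] [Field F] [Algebra ℂ K]
  [Algebra ℂ L] [Algebra ℂ F]

lemma pullForm_smul (f : K →ₐ[ℂ] L) (a : K) (ω : Forms n K) :
    pullForm n f (a • ω) = f a • pullForm n f ω := by
  let _ : Algebra K L := f.toRingHom.toAlgebra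
  have : IsScalarTower ℂ K L := IsScalarTower.of_algebraMap_eq (fun r => (f.commutes r).symm)
  let _ : Module K (Forms n L) := Module.compHom _ f.toRingHom
  exact LinearMap.map_smul _ a ω

lemma pullForm_dWedge (f : K →ₐ[ℂ] L) (s : Fin n → K) :
    pullForm n f (dWedge s) = dWedge fun i ↦ f (s i) := by
  let _ : Algebra K L := f.toRingHom.toAlgebra
  have : IsScalarTower ℂ K L := IsScalarTower.of_algebraMap_eq (fun r => (f.commutes r).symm)
  let _ : Module K (Forms n L) := Module.compHom _ f.toRingHom
  refine (exteriorPower.alternatingMapLinearEquiv_apply_ιMulti _ _).trans ?_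
  refine congrArg (exteriorPower.ιMulti L n) (funext fun i ↦ ?_)
  exact KaehlerDifferential.map_D ℂ ℂ K L (s i)

end PullForm

/-! ### Pull-back of rational functions and birational morphisms -/

section PullFun
variable {Y X Z : Scheme.{0}} [Y.Over SpecC] [X.Over SpecC] [Z.Over SpecC] [IsVariety Y]
  [IsVariety X] [IsVariety Z]

/-- On a function regular at `f y`, the pull-back of rational functions is the map of local
rings. -/
lemma pullFun_algebraMap (f : Y ⟶ X) [IsDominant f] [f.IsOver SpecC] (y : Y)
    (s : X.presheaf.stalk (f y)) :
    pullFun f (algebraMap _ X.functionField s) =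
      algebraMap _ Y.functionField (f.stalkMap y s) := by
  have h : (X.presheaf.stalkSpecializes ((genericPoint_spec X).specializes trivial) ≫
      X.presheaf.stalkSpecializes (genericPoint_specializes_of_isDominant f)) ≫
        f.stalkMap (genericPoint Y) =
      f.stalkMap y ≫ Y.presheaf.stalkSpecializes ((genericPoint_spec Y).specializes trivial) := by
    rw [TopCat.Presheaf.stalkSpecializes_comp]
    exact Scheme.Hom.stalkSpecializes_stalkMap f _ _ _
  exact congr($(h).hom s)

lemma pullFun_germ (f : Y ⟶ X) [IsDominant f] [f.IsOver SpecC] {W : X.Opens}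
    (hW : genericPoint X ∈ W) (hW' : genericPoint Y ∈ f ⁻¹ᵁ W) (σ : Γ(X, W)) :
    pullFun f (X.presheaf.germ W _ hW σ) = Y.presheaf.germ (f ⁻¹ᵁ W) _ hW' (f.app W σ) := by
  have h : X.presheaf.germ W _ hW ≫
      X.presheaf.stalkSpecializes (genericPoint_specializes_of_isDominant f) ≫
        f.stalkMap (genericPoint Y) = f.app W ≫ Y.presheaf.germ (f ⁻¹ᵁ W) _ hW' := by
    rw [TopCat.Presheaf.germ_stalkSpecializes_assoc]
    exact Scheme.Hom.germ_stalkMap f W (genericPoint Y) hW'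
  exact congr($(h).hom σ)

lemma pullFun_comp {f : Y ⟶ X} {g : X ⟶ Z} {h : Y ⟶ Z} (hfg : f ≫ g = h) [IsDominant f]
    [f.IsOver SpecC] [IsDominant g] [g.IsOver SpecC] [IsDominant h] [h.IsOver SpecC]
    (φ : Z.functionField) : pullFun h φ = pullFun f (pullFun g φ) := by
  subst hfg
  obtain ⟨W, hW, σ, rfl⟩ := Z.presheaf.exists_germ_eq φ
  have hX : genericPoint X ∈ g ⁻¹ᵁ W :=
    (genericPoint_specializes_of_isDominant g).mem_open W.isOpen hW
  have hY : genericPoint Y ∈ f ⁻¹ᵁ g ⁻¹ᵁ W :=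
    (genericPoint_specializes_of_isDominant f).mem_open (g ⁻¹ᵁ W).isOpen hX
  rw [pullFun_germ g hW hX, pullFun_germ f hX hY, pullFun_germ (f ≫ g) hW hY,
    Scheme.Hom.comp_app]
  rfl

lemma pullFun_ne_zero (f : Y ⟶ X) [IsDominant f] [f.IsOver SpecC] {φ : X.functionField}
    (hφ : φ ≠ 0) : pullFun f φ ≠ 0 := by
  simpa using hφ

lemma isDominant_of_isOpenImmersion (f : Y ⟶ X) [IsOpenImmersion f] : IsDominant f :=
  ⟨f.isOpenEmbedding.isOpen_range.dense (Set.range_nonempty _)⟩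

lemma pullFun_surjective_of_isOpenImmersion (f : Y ⟶ X) [IsOpenImmersion f] [IsDominant f]
    [f.IsOver SpecC] : Function.Surjective (pullFun f) := by
  intro φ
  obtain ⟨s, hs⟩ := (ConcreteCategory.bijective_of_isIso (f.stalkMap (genericPoint Y))).2 φ
  refine ⟨algebraMap _ X.functionField s, ?_⟩
  rw [pullFun_algebraMap, hs]
  exact congr($(Y.presheaf.stalkSpecializes_refl (genericPoint Y)).hom φ)

instance isVariety_opens (U : X.Opens) [Nonempty U] : IsVariety U.toScheme where
  isIntegral := inferInstance
  isSeparated := by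
    have := IsVariety.isSeparated (X := X)
    rw [← Scheme.Opens.ι_comp_over]; infer_instance
  locallyOfFiniteType := by
    have := IsVariety.locallyOfFiniteType (X := X)
    rw [← Scheme.Opens.ι_comp_over]; infer_instance
  quasiCompact := by
    have := IsVariety.quasiCompact (X := X)
    rw [← Scheme.Opens.ι_comp_over]
    infer_instance

lemma pullFun_bijective (π : Y ⟶ X) [hπ : IsBirationalMorphism π] [π.IsOver SpecC] :
    Function.Bijective (pullFun π) := by
  refine ⟨(pullFun π).toRingHom.injective, ?_⟩
  obtain ⟨U, hU, h⟩ := hπ.exists_open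
  have : Nonempty U := hU.to_subtype
  have : IsDominant U.ι := isDominant_of_isOpenImmersion U.ι
  have : U.ι.IsOver SpecC := ⟨rfl⟩
  intro φ
  obtain ⟨ψ, hψ⟩ := pullFun_surjective_of_isOpenImmersion (U.ι ≫ π) (pullFun U.ι φ)
  refine ⟨ψ, (pullFun U.ι).toRingHom.injective ?_⟩
  exact (pullFun_comp rfl ψ).symm.trans hψ

end PullFun

/-! ### Units on normal varieties -/

section HartogsSchemes
variable {X : Scheme.{0}} [X.Over SpecC] [IsVariety X]

/-- A prime of height one of `𝒪_{X,y}` is a point `z` of codimension one specializing to `y`, and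
`𝒪_{X,z}` is contained in the localization at this prime, inside the function field. -/
lemma exists_stalk_of_height_eq_one {y : X} (p : Ideal (X.presheaf.stalk y)) [p.IsPrime]
    (hp : p.height = 1) : ∃ z : X, z ⤳ y ∧ coheight z = 1 ∧
      ∀ u : X.presheaf.stalk z, ∃ a : X.presheaf.stalk y, ∃ s ∉ p,
        algebraMap _ X.functionField s * algebraMap _ X.functionField u =
          algebraMap _ X.functionField a := by
  obtain ⟨_, ⟨V, hV, rfl⟩, hyV, -⟩ :=
    X.isBasis_affineOpens.exists_subset_of_mem_open (Set.mem_univ y) isOpen_univ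
  have : Nonempty V := ⟨⟨y, hyV⟩⟩
  let y' : V := ⟨y, hyV⟩
  let _ : Algebra Γ(X, V) (X.presheaf.stalk y) := X.presheaf.algebra_section_stalk y'
  have := hV.isLocalization_stalk y'
  let q : PrimeSpectrum Γ(X, V) :=
    ⟨p.comap (algebraMap Γ(X, V) (X.presheaf.stalk y)), inferInstance⟩
  have hqy : q ≤ hV.primeIdealOf y' := fun a ha ↦ by
    by_contra hay
    exact ‹p.IsPrime›.ne_top (Ideal.eq_top_of_isUnit_mem _ ha (IsLocalization.map_units
      (X.presheaf.stalk y) (⟨a, hay⟩ : (hV.primeIdealOf y').asIdeal.primeCompl)))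
  let z : X := hV.fromSpec q
  have hzV : z ∈ V := (hV.isoSpec.inv q).2
  let _ : Algebra Γ(X, V) (X.presheaf.stalk z) := X.presheaf.algebra_section_stalk ⟨z, hzV⟩
  have hz : IsLocalization.AtPrime (X.presheaf.stalk z) q.asIdeal := hV.isLocalization_stalk' q hzV
  have hzy : z ⤳ y := by
    have := ((PrimeSpectrum.le_iff_specializes _ _).mp hqy).map hV.fromSpec.continuous
    rwa [hV.fromSpec_primeIdealOf] at this
  have hz1 : coheight z = 1 := by
    have h1 := ringKrullDim_stalk_eq_coheight z
    rw [IsLocalization.AtPrime.ringKrullDim_eq_height q.asIdeal,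
      IsLocalization.height_under (hV.primeIdealOf y').asIdeal.primeCompl, hp] at h1
    exact_mod_cast h1.symm
  refine ⟨z, hzy, hz1, fun u ↦ ?_⟩
  obtain ⟨a, s, rfl⟩ := IsLocalization.exists_mk'_eq q.asIdeal.primeCompl u
  refine ⟨algebraMap _ _ a, algebraMap _ _ (s : Γ(X, V)), fun h ↦ s.2 h, ?_⟩
  have : IsScalarTower Γ(X, V) (X.presheaf.stalk z) X.functionField :=
    functionField_isScalarTower X V ⟨z, hzV⟩
  have : IsScalarTower Γ(X, V) (X.presheaf.stalk y) X.functionField :=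
    functionField_isScalarTower X V y'
  rw [← IsScalarTower.algebraMap_apply, ← IsScalarTower.algebraMap_apply,
    IsScalarTower.algebraMap_apply _ (X.presheaf.stalk z), ← map_mul, IsLocalization.mk'_spec',
    ← IsScalarTower.algebraMap_apply]

/-- On a normal variety, a rational function without zeros and poles in codimension one near `y`
is a unit at `y`. -/
lemma exists_isUnit_algebraMap_eq [IsNormalScheme X] {y : X} {φ : X.functionField} (hφ : φ ≠ 0)
    {U : X.Opens} (hy : y ∈ U) (h : ∀ z ∈ U, coheight z = 1 → Scheme.ord φ z = 0) :
    ∃ u : X.presheaf.stalk y, IsUnit u ∧ algebraMap _ X.functionField u = φ := by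
  have := IsNormalScheme.isIntegrallyClosed_stalk y
  have key (ψ : X.functionField) (hψ0 : ψ ≠ 0)
      (hψ : ∀ z ∈ U, coheight z = 1 → Scheme.ord ψ z = 0) :
      ∃ a, algebraMap (X.presheaf.stalk y) X.functionField a = ψ := by
    refine exists_algebraMap_eq_of_forall_height_eq_one ψ fun p hp hp1 ↦ ?_
    obtain ⟨z, hzy, hz, hu⟩ := exists_stalk_of_height_eq_one p hp1
    have := isDiscreteValuationRing_stalk hz
    obtain ⟨t, ht⟩ := IsDiscreteValuationRing.exists_irreducible (X.presheaf.stalk z)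
    obtain ⟨u, -, rfl⟩ : ∃ u : X.presheaf.stalk z, IsUnit u ∧
        algebraMap _ X.functionField u = ψ := by
      obtain ⟨u, hu, hψu⟩ := exists_unit_mul_zpow hz ht hψ0
      exact ⟨u, hu, by rw [hψu, hψ z (hzy.mem_open U.isOpen hy) hz, zpow_zero, mul_one]⟩
    exact hu u
  obtain ⟨a, ha⟩ := key φ hφ h
  obtain ⟨b, hb⟩ := key φ⁻¹ (inv_ne_zero hφ) fun z hz hz1 ↦ by rw [ord_inv hφ, h z hz hz1, neg_zero]
  refine ⟨a, .of_mul_eq_one b (IsFractionRing.injective _ X.functionField ?_), ha⟩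
  rw [map_mul, ha, hb, mul_inv_cancel₀ hφ, map_one]

end HartogsSchemes

/-! ### Orders of `ℚ`-Cartier divisors -/

section OrdDiv
variable {Y X : Scheme.{0}} [Y.Over SpecC] [X.Over SpecC] [IsVariety Y] [IsVariety X]

lemma ordFun_mul (f : Y ⟶ X) [IsDominant f] [f.IsOver SpecC] (e : Y) {φ ψ : X.functionField}
    (hφ : φ ≠ 0) (hψ : ψ ≠ 0) : ordFun f e (φ * ψ) = ordFun f e φ + ordFun f e ψ := by
  rw [ordFun, map_mul, Scheme.ord_mul (pullFun_ne_zero f hφ) (pullFun_ne_zero f hψ)]; rfl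

lemma ordFun_div (f : Y ⟶ X) [IsDominant f] [f.IsOver SpecC] (e : Y) {φ ψ : X.functionField}
    (hφ : φ ≠ 0) (hψ : ψ ≠ 0) : ordFun f e (φ / ψ) = ordFun f e φ - ordFun f e ψ := by
  rw [ordFun, map_div₀, ord_div (pullFun_ne_zero f hφ) (pullFun_ne_zero f hψ)]; rfl

lemma ordFun_pow (f : Y ⟶ X) [IsDominant f] [f.IsOver SpecC] (e : Y) {φ : X.functionField}
    (hφ : φ ≠ 0) (n : ℕ) : ordFun f e (φ ^ n) = n * ordFun f e φ := by
  rw [ordFun, map_pow, ord_pow (pullFun_ne_zero f hφ)]; rfl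

/-- The order of a `ℚ`-Cartier divisor along `E` does not depend on the local equation: if `φ` and
`ψ` are local equations of `p D` and `q D`, then `φ ^ q / ψ ^ p` is a unit at `f e`. -/
lemma ordDiv_eq [IsNormalScheme X] (f : Y ⟶ X) [IsDominant f] [f.IsOver SpecC] {e : Y} {D : X → ℚ}
    {p : ℕ} (hp : 0 < p) {φ : X.functionField} (hφ : IsLocalEquation (fun z ↦ p * D z) (f e) φ) :
    ordDiv f e D = ordFun f e φ / p := by
  have h : ∃ p : ℕ × X.functionField, 0 < p.1 ∧
    IsLocalEquation (fun z => p.1 * D z) (f e) p.2 := ⟨(p, φ), hp, hφ⟩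
  rw [ordDiv, dif_pos h]
  obtain ⟨hq, hψ⟩ := h.choose_spec
  generalize h.choose = qψ at hq hψ ⊢
  obtain ⟨q, ψ⟩ := qψ
  obtain ⟨hφ0, U, hU, hUφ⟩ := hφ
  obtain ⟨hψ0, V, hV, hVψ⟩ := hψ
  dsimp only at hq hψ0 hV hVψ ⊢
  have hφq := pow_ne_zero q hφ0
  have hψp := pow_ne_zero p hψ0
  obtain ⟨u, hu, hu'⟩ := exists_isUnit_algebraMap_eq (y := f e) (U := U ⊓ V)
    (div_ne_zero hφq hψp) ⟨hU, hV⟩ fun z hz hz1 ↦ by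
      rw [ord_div hφq hψp, ord_pow hφ0, ord_pow hψ0]
      have h1 := hUφ z hz.1 hz1
      have h2 := hVψ z hz.2 hz1
      have : ((q * Scheme.ord φ z - p * Scheme.ord ψ z : ℤ) : ℚ) = 0 := by
        push_cast
        rw [h1, h2]
        ring
      exact_mod_cast this
  have h0 : ordFun f e (φ ^ q / ψ ^ p) = 0 := by
    rw [← hu', ordFun, pullFun_algebraMap, ord_algebraMap_of_isUnit (hu.map (f.stalkMap e).hom)]
  rw [ordFun_div f e hφq hψp, ordFun_pow f e hφ0, ordFun_pow f e hψ0] at h0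
  have h0' : (q * ordFun f e φ - p * ordFun f e ψ : ℚ) = 0 := by exact_mod_cast h0
  rw [div_eq_div_iff (by positivity) (by positivity)]
  linarith

end OrdDiv

/-! ### Canonical divisors -/

section CanonicalDivisor
variable {X : Scheme.{0}} [X.Over SpecC] [IsVariety X]

instance : CompactSpace X := by
  have := IsVariety.quasiCompact (X := X)
  exact (quasiCompact_iff_compactSpace (X ↘ SpecC)).mp this

instance : IsNoetherian X where

lemma eq_genericPoint_of_coheight_eq_zero {x : X} (hx : coheight x = 0) : x = genericPoint X :=
  have h : IsMax x := coheight_eq_zero.mp hx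
  have h' := h (b := genericPoint X) (genericPoint_specializes x)
  ((genericPoint_specializes x).antisymm h').eq.symm

lemma eq_or_eq_genericPoint_of_specializes {w z : X} (hz : coheight z = 1) (h : w ⤳ z) :
    w = z ∨ w = genericPoint X := by
  by_cases hzw : z ⤳ w
  · exact .inl (h.antisymm hzw).eq
  · have hlt : z < w := ⟨h, hzw⟩
    have h1 := coheight_add_one_le hlt
    rw [hz] at h1
    refine .inr (eq_genericPoint_of_coheight_eq_zero ?_)
    exact Order.lt_one_iff.mp ((ENat.add_one_le_iff fun h ↦ by simp [h] at h1).mp h1)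

lemma exists_eq_smul_of_ne_zero {ω : Forms (dim X) X.functionField} (hω : ω ≠ 0)
    (η : Forms (dim X) X.functionField) : ∃ J : X.functionField, η = J • ω := by
  obtain ⟨t, ht⟩ := exists_isLocalCoords_genericPoint (X := X)
  obtain ⟨a, rfl⟩ := exists_eq_smul_coordForm ht ω
  obtain ⟨b, rfl⟩ := exists_eq_smul_coordForm ht η
  have ha : a ≠ 0 := by rintro rfl; simp at hω
  exact ⟨b / a, by rw [smul_smul, div_mul_cancel₀ _ ha]⟩

lemma exists_isLocalCoords_nhds {y : X} {t : Fin (dim X) → X.presheaf.stalk y}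
    (ht : IsLocalCoords y t) : ∃ U : X.Opens, y ∈ U ∧ ∀ z ∈ U,
      ∃ s : Fin (dim X) → X.presheaf.stalk z, IsLocalCoords z s ∧ coordForm s = coordForm t := by
  obtain ⟨U, hyU, hU⟩ := exists_coords_nhds ht.2.ge
  refine ⟨U, hyU, fun z hz ↦ ?_⟩
  obtain ⟨s, hs, hst⟩ := hU z hz
  exact ⟨s, isLocalCoords_iff.mpr hs, congrArg dWedge (funext hst)⟩

/-- Near a point with local coordinates, `div(ω)` is Cartier, with the coefficient of `ω` in these
coordinates as a local equation. -/
lemma isLocalEquation_divForm {y : X} {t : Fin (dim X) → X.presheaf.stalk y}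
    (ht : IsLocalCoords y t) {ω : Forms (dim X) X.functionField} {a : X.functionField}
    (hω : ω = a • coordForm t) (hω0 : ω ≠ 0) : IsLocalEquation (divForm ω) y a := by
  obtain ⟨U, hyU, hU⟩ := exists_isLocalCoords_nhds ht
  refine ⟨by rintro rfl; simp [hω] at hω0, U, hyU, fun z hz _ ↦ ?_⟩
  obtain ⟨s, hs, hst⟩ := hU z hz
  rw [divForm, ordForm_of_eq_smul_coordForm hs (hst ▸ hω)]

lemma ordForm_smul [IsNormalScheme X] {n : ℕ} (hn : dim X = n) {z : X} (hz : coheight z = 1)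
    {J : X.functionField} (hJ : J ≠ 0) {ω : Forms n X.functionField} (hω : ω ≠ 0) :
    ordForm (J • ω) z = Scheme.ord J z + ordForm ω z := by
  subst hn
  obtain ⟨t, ht⟩ := exists_isLocalCoords hz
  obtain ⟨a, rfl⟩ := exists_eq_smul_coordForm ht ω
  have ha : a ≠ 0 := by rintro rfl; simp at hω
  rw [ordForm_of_eq_smul_coordForm ht (smul_smul ..), ordForm_of_eq_smul_coordForm ht rfl,
    Scheme.ord_mul hJ ha]

/-- Only finitely many prime divisors lie outside a nonempty open set: they are irreducible
components of the complement. -/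
lemma finite_coheight_eq_one_notMem {U : X.Opens} (hU : genericPoint X ∈ U) :
    {z : X | coheight z = 1 ∧ z ∉ U}.Finite := by
  obtain ⟨S, hS, hSc, hSi, hSU⟩ :=
    TopologicalSpace.NoetherianSpace.exists_finite_set_isClosed_irreducible U.isOpen.isClosed_compl
  have hS' (T : Set X) : ∃ w : X, T ∈ S → IsGenericPoint w T := by
    by_cases hT : T ∈ S
    · obtain ⟨w, hw⟩ := QuasiSober.sober (hSi T hT) (hSc T hT)
      exact ⟨w, fun _ ↦ hw⟩
    · exact ⟨genericPoint X, fun h ↦ absurd h hT⟩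
  choose w hw using hS'
  refine (hS.image w).subset fun z hz ↦ ?_
  obtain ⟨T, hT, hzT⟩ := Set.mem_sUnion.mp (hSU ▸ hz.2 : z ∈ ⋃₀ S)
  have hwz := eq_or_eq_genericPoint_of_specializes hz.1 ((hw T hT).specializes hzT)
  refine ⟨T, hT, hwz.resolve_right fun h ↦ ?_⟩
  have h1 : w T ∈ (U : Set X)ᶜ := hSU ▸ Set.mem_sUnion_of_mem (hw T hT).mem hT
  exact h1 (h ▸ hU)

lemma exists_nhds_ordForm_eq_zero {ω : Forms (dim X) X.functionField} (hω : ω ≠ 0) :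
    ∃ U : X.Opens, genericPoint X ∈ U ∧ ∀ z ∈ U, ordForm ω z = 0 := by
  obtain ⟨t, ht⟩ := exists_isLocalCoords_genericPoint (X := X)
  obtain ⟨a, rfl⟩ := exists_eq_smul_coordForm ht ω
  have ha : a ≠ 0 := by rintro rfl; simp at hω
  obtain ⟨U, hU, h⟩ := exists_isLocalCoords_nhds ht
  obtain ⟨V, -, f, hV, rfl, hf⟩ := exists_isUnit_germ_eq X a ha
  refine ⟨U ⊓ V, ⟨hU, ((genericPoint_spec X).mem_open_set_iff V.isOpen).mpr (by simpa using hV)⟩,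
    fun z hz ↦ ?_⟩
  obtain ⟨s, hs, hst⟩ := h z hz.1
  rw [ordForm_of_eq_smul_coordForm hs (show _ • coordForm t = _ • coordForm s by rw [hst]),
    Scheme.ord_of_isUnit hf hz.2]

/-- On a `ℚ`-factorial variety some positive multiple of a canonical divisor is Cartier. -/
lemma exists_isLocalEquation_divForm (hX : IsQFactorial X) {ω : Forms (dim X) X.functionField}
    (hω : ω ≠ 0) : ∃ m : ℕ, 0 < m ∧ ∀ y : X, ∃ φ : X.functionField,
      IsLocalEquation (fun z ↦ m * divForm ω z) y φ := by
  classical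
  obtain ⟨U, hU, h0⟩ := exists_nhds_ordForm_eq_zero hω
  -- `ordForm` is not constrained at points that are not of codimension one, hence the cut-off
  let D : AlgebraicCycle X ℤ :=
    { toFun := fun z ↦ if coheight z = 1 then ordForm ω z else 0
      supportWithinDomain' := Set.subset_univ _
      supportLocallyFiniteWithinDomain' := fun z _ ↦ ⟨Set.univ, Filter.univ_mem, by
        refine (finite_coheight_eq_one_notMem hU).subset fun z hz ↦ ?_
        have hz := hz.2
        simp only [Function.mem_support, ne_eq, ite_eq_right_iff, Classical.not_imp] at hz
        exact ⟨hz.1, fun h ↦ hz.2 (h0 z h)⟩⟩ }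
  obtain ⟨m, hm, h⟩ := hX D fun x hx ↦ by
    by_contra hx1
    exact hx (if_neg hx1)
  refine ⟨m, hm, fun y ↦ ?_⟩
  obtain ⟨φ, hφ0, V, hyV, hV⟩ := h y
  refine ⟨φ, hφ0, V, hyV, fun z hz hz1 ↦ ?_⟩
  rw [hV z hz hz1]
  exact congrArg (fun i : ℤ ↦ (m * i : ℚ)) (if_pos hz1)

end CanonicalDivisor

/-! ### Ramification along prime divisors -/

section Extensions
variable {Y X Z : Scheme.{0}} [Y.Over SpecC] [X.Over SpecC] [Z.Over SpecC] [IsVariety Y]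
  [IsVariety X] [IsVariety Z]

lemma dim_eq_of_bijective (f : X.functionField →ₐ[ℂ] Y.functionField) (hf : Function.Bijective f) :
    dim Y = dim X :=
  congrArg Cardinal.toNat (AlgEquiv.ofBijective f hf).trdeg_eq.symm

/-- If `π y` is the generic point, then `𝒪_{Y,y}` contains the whole function field, so `y` is
generic. -/
lemma eq_genericPoint_of_birational (π : Y ⟶ X) [IsBirationalMorphism π] [π.IsOver SpecC]
    {y : Y} (hy : π y = genericPoint X) : y = genericPoint Y := by
  have hsurj : Function.Surjective (algebraMap (Y.presheaf.stalk y) Y.functionField) := by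
    intro φ
    obtain ⟨ψ, rfl⟩ := (pullFun_bijective π).2 φ
    obtain ⟨s, rfl⟩ : ∃ s : X.presheaf.stalk (π y), algebraMap _ X.functionField s = ψ := by
      rw [hy]
      exact ⟨ψ, congr($(X.presheaf.stalkSpecializes_refl (genericPoint X)).hom ψ)⟩
    exact ⟨_, (pullFun_algebraMap π y s).symm⟩
  have hf : IsField (Y.presheaf.stalk y) := by
    refine ((RingEquiv.ofBijective (algebraMap (Y.presheaf.stalk y) Y.functionField)
      ⟨IsFractionRing.injective _ _, hsurj⟩).toMulEquiv.isField (Field.toIsField _))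
  refine eq_genericPoint_of_coheight_eq_zero ?_
  have h := ringKrullDim_stalk_eq_coheight y
  rw [ringKrullDim_eq_zero_of_isField hf] at h
  exact_mod_cast h.symm

/-- A map to `Y` is dominant if its composition with a birational morphism is, since only the
generic point of `Y` lies over the generic point of `X`. -/
lemma isDominant_of_comp_birational {h : Z ⟶ Y} (π : Y ⟶ X) [IsBirationalMorphism π]
    [π.IsOver SpecC] [IsDominant (h ≫ π)] : IsDominant h := by
  have h1 : π (h (genericPoint Z)) = genericPoint X :=
    ((genericPoint_specializes (π (h (genericPoint Z)))).antisymm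
      (genericPoint_specializes_of_isDominant (h ≫ π))).eq.symm
  have h2 := eq_genericPoint_of_birational π h1
  refine ⟨Dense.mono (Set.singleton_subset_iff.mpr ⟨_, h2⟩) ?_⟩
  exact dense_iff_closure_eq.mpr (genericPoint_spec Y)

/-- A dominant morphism mapping a prime divisor onto a prime divisor induces an extension of
discrete valuation rings, with some ramification index `r`. -/
lemma exists_stalkMap_eq_unit_mul_pow [IsNormalScheme Y] [IsNormalScheme X] (f : Y ⟶ X)
    [IsDominant f] [f.IsOver SpecC] {y : Y} (hy : coheight y = 1) (hfy : coheight (f y) = 1)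
    {t : Y.presheaf.stalk y} (ht : Irreducible t) {s : X.presheaf.stalk (f y)}
    (hs : Irreducible s) :
    ∃ r : ℕ, 0 < r ∧ (∃ u, IsUnit u ∧ f.stalkMap y s = u * t ^ r) ∧
      ∀ φ : X.functionField, φ ≠ 0 → ordFun f y φ = r * Scheme.ord φ (f y) := by
  have := isDiscreteValuationRing_stalk hy
  have hs0 : f.stalkMap y s ≠ 0 := fun h ↦ by
    have h1 := pullFun_algebraMap f y s
    rw [h, map_zero] at h1
    exact pullFun_ne_zero f (by simpa using hs.ne_zero) h1
  obtain ⟨r, u, hu⟩ := IsDiscreteValuationRing.eq_unit_mul_pow_irreducible hs0 ht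
  have hr : 0 < r := by
    rw [pos_iff_ne_zero]
    rintro rfl
    refine hs.not_isUnit (isUnit_of_map_unit (f.stalkMap y).hom s ?_)
    exact hu ▸ by simp
  have ht0 : algebraMap _ Y.functionField t ≠ 0 := by simpa using ht.ne_zero
  have hs0' : algebraMap _ X.functionField s ≠ 0 := by simpa using hs.ne_zero
  have hrs : ordFun f y (algebraMap _ X.functionField s) = r := by
    rw [ordFun, pullFun_algebraMap, hu, map_mul, map_pow, Scheme.ord_mul (u.isUnit.map _).ne_zero
      (pow_ne_zero _ ht0), ord_pow ht0, ord_algebraMap_of_isUnit u.isUnit,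
      ord_algebraMap_of_irreducible hy ht]
    simp
  refine ⟨r, hr, ⟨u, u.isUnit, hu⟩, fun φ hφ ↦ ?_⟩
  obtain ⟨v, hv, hφv⟩ := exists_unit_mul_zpow hfy hs hφ
  have hz (n : ℤ) : ordFun f y (algebraMap _ X.functionField s ^ n) = r * n := by
    obtain ⟨n, rfl | rfl⟩ := n.eq_nat_or_neg
    · rw [zpow_natCast, ordFun_pow f y hs0', hrs, mul_comm]
    · rw [zpow_neg, zpow_natCast, ordFun, map_inv₀,
        ord_inv (pullFun_ne_zero f (pow_ne_zero _ hs0'))]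
      have := ordFun_pow f y hs0' n
      rw [ordFun] at this
      rw [this, hrs]
      ring
  conv_lhs => rw [hφv]
  rw [ordFun_mul f y (hv.map _).ne_zero (zpow_ne_zero _ hs0'), hz, ordFun, pullFun_algebraMap,
    ord_algebraMap_of_isUnit (hv.map (f.stalkMap y).hom), zero_add]

lemma exists_ord_eq_one [IsNormalScheme X] {x : X} (hx : coheight x = 1) :
    ∃ φ : X.functionField, φ ≠ 0 ∧ Scheme.ord φ x = 1 := by
  have := isDiscreteValuationRing_stalk hx
  obtain ⟨t, ht⟩ := IsDiscreteValuationRing.exists_irreducible (X.presheaf.stalk x)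
  exact ⟨_, by simpa using ht.ne_zero, ord_algebraMap_of_irreducible hx ht⟩

lemma ordForm_smul_coordForm {n : ℕ} (hn : dim X = n) {x : X} {t : Fin n → X.presheaf.stalk x}
    (ht : ⊤ ≤ Submodule.span (X.presheaf.stalk x)
      (Set.range fun i ↦ KaehlerDifferential.D ℂ (X.presheaf.stalk x) (t i)))
    (a : X.functionField) : ordForm (a • coordForm t) x = Scheme.ord a x := by
  subst hn
  exact ordForm_of_eq_smul_coordForm (isLocalCoords_iff.mpr ht) rfl

open IsLocalRing in
/-- When the dimensions agree, the residue field extension at points of codimension one is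
algebraic: a transcendence basis of the residue field at `f y` pulls back to one at `y`. -/
lemma exists_isTranscendenceBasis_stalkMap [IsNormalScheme Y] [IsNormalScheme X] (f : Y ⟶ X)
    [IsDominant f] [f.IsOver SpecC] (hdim : dim Y = dim X) {y : Y} (hy : coheight y = 1)
    (hfy : coheight (f y) = 1) : ∃ d : ℕ, dim X = d + 1 ∧ ∃ s : Fin d → X.presheaf.stalk (f y),
      IsTranscendenceBasis ℂ (fun i ↦ residue _ (s i)) ∧
      IsTranscendenceBasis ℂ (fun i ↦ residue _ (f.stalkMap y (s i))) := by
  obtain ⟨d, hd, -, s, hs⟩ := exists_isTranscendenceBasis_residueField hfy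
  obtain ⟨d', hd', hd'', -⟩ := exists_isTranscendenceBasis_residueField hy
  have hc : scalarsToStalk X (f y) ≫ f.stalkMap y = scalarsToStalk Y y := by
    have hf : f ≫ (X ↘ SpecC) = Y ↘ SpecC := comp_over f SpecC
    simp only [scalarsToStalk, Category.assoc]
    rw [Scheme.Hom.germ_stalkMap, ← hf]
    rfl
  let F : ResidueField (X.presheaf.stalk (f y)) →ₐ[ℂ] ResidueField (Y.presheaf.stalk y) :=
    { ResidueField.map (f.stalkMap y).hom with
      commutes' := fun c ↦ by
        have h1 : algebraMap ℂ (ResidueField (X.presheaf.stalk (f y))) c =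
          residue _ (scalarsToStalk X (f y) c) := rfl
        have h2 : algebraMap ℂ (ResidueField (Y.presheaf.stalk y)) c =
          residue _ (scalarsToStalk Y y c) := rfl
        rw [h1, h2, ← hc]
        rfl }
  have hF : AlgebraicIndependent ℂ fun i ↦ residue _ (f.stalkMap y (s i)) :=
    hs.1.map' (f := F) F.toRingHom.injective
  have hle : Algebra.trdeg ℂ (ResidueField (Y.presheaf.stalk y)) ≤ Cardinal.mk (Fin d) := by
    rw [hd'', Cardinal.mk_fin]
    exact_mod_cast (by omega : d' ≤ d)
  have := hF.isTranscendenceBasis_of_trdeg_le_of_finite hle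
  exact ⟨d, hd, s, hs, this⟩

open IsLocalRing in
/-- The ramification formula along prime divisors: if `f` has ramification index `r` along the
prime divisor with generic point `y`, then pull-back multiplies the order of functions by `r` and
also the log order `ord + 1` of forms of top degree. -/
theorem exists_ramificationIndex [IsNormalScheme Y] [IsNormalScheme X] (f : Y ⟶ X)
    [IsDominant f] [f.IsOver SpecC] {n : ℕ} (hY : dim Y = n) (hX : dim X = n) {y : Y}
    (hy : coheight y = 1) (hfy : coheight (f y) = 1) :
    ∃ r : ℕ, 0 < r ∧ (∀ φ : X.functionField, φ ≠ 0 → ordFun f y φ = r * Scheme.ord φ (f y)) ∧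
      ∀ η : Forms n X.functionField, η ≠ 0 →
        ordForm (pullForm n (pullFun f) η) y + 1 = r * (ordForm η (f y) + 1) := by
  have := isDiscreteValuationRing_stalk hy
  have := isDiscreteValuationRing_stalk hfy
  obtain ⟨t, ht⟩ := IsDiscreteValuationRing.exists_irreducible (Y.presheaf.stalk y)
  obtain ⟨t', ht'⟩ := IsDiscreteValuationRing.exists_irreducible (X.presheaf.stalk (f y))
  obtain ⟨r, hr, ⟨u, hu, htu⟩, hord⟩ := exists_stalkMap_eq_unit_mul_pow f hy hfy ht ht'
  refine ⟨r, hr, hord, fun η hη ↦ ?_⟩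
  obtain ⟨d, hd, s, hs, hs'⟩ := exists_isTranscendenceBasis_stalkMap f (hY.trans hX.symm) hy hfy
  obtain rfl : n = d + 1 := hX.symm.trans hd
  have hX' := span_D_cons_eq_top_of_isTranscendenceBasis ht'.maximalIdeal_eq hs
  have hY' := span_D_cons_eq_top_of_isTranscendenceBasis ht.maximalIdeal_eq hs'
  obtain ⟨b, hb⟩ := exists_smul_dWedge_eq (K := X.functionField)
    (span_map_kaehlerDifferential_eq_top hX') η
  have hb0 : b ≠ 0 := by rintro rfl; simp [hb] at hη
  obtain ⟨w, hw, hwr⟩ := dWedge_cons_unit_mul_pow (K := Y.functionField) hr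
    (ht.maximalIdeal_eq ▸ Ideal.mem_span_singleton_self t) hY' hu
  have hcons : (fun i ↦ pullFun f (algebraMap _ X.functionField
      ((Fin.cons t' s : Fin (d + 1) → X.presheaf.stalk (f y)) i))) = fun i ↦
      algebraMap _ Y.functionField ((Fin.cons (u * t ^ r) (fun i ↦ f.stalkMap y (s i)) :
        Fin (d + 1) → Y.presheaf.stalk y) i) := by
    funext i
    rw [pullFun_algebraMap]
    refine Fin.cases ?_ (fun i ↦ ?_) i
    · rw [Fin.cons_zero, Fin.cons_zero, htu]
    · rw [Fin.cons_succ, Fin.cons_succ]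
  have hη1 : ordForm η (f y) = Scheme.ord b (f y) := by
    rw [hb]; exact ordForm_smul_coordForm hX hX' b
  have hη2 : ordForm (pullForm (d + 1) (pullFun f) η) y =
      Scheme.ord (pullFun f b * algebraMap _ Y.functionField (t ^ (r - 1) * w)) y := by
    rw [hb, pullForm_smul, pullForm_dWedge, hcons, hwr, smul_smul]
    exact ordForm_smul_coordForm hY hY' _
  have ht0 : algebraMap _ Y.functionField t ≠ 0 := by simpa using ht.ne_zero
  have h1 := hord b hb0
  rw [ordFun] at h1
  rw [hη1, hη2, map_mul, map_pow, Scheme.ord_mul (pullFun_ne_zero f hb0)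
    (mul_ne_zero (pow_ne_zero _ ht0) (hw.map _).ne_zero), Scheme.ord_mul (pow_ne_zero _ ht0)
    (hw.map _).ne_zero, ord_pow ht0, ord_algebraMap_of_isUnit hw,
    ord_algebraMap_of_irreducible hy ht, h1]
  push_cast [hr]
  ring

end Extensions

/-! ### Functoriality of the pull-back of forms -/

section PullFormOnVarieties
variable {Y X : Scheme.{0}} [Y.Over SpecC] [X.Over SpecC] [IsVariety Y] [IsVariety X]

lemma pullForm_comp {L F : Type} [Field L] [Field F] [Algebra ℂ L] [Algebra ℂ F] {n : ℕ}
    (hn : dim X = n) {f : X.functionField →ₐ[ℂ] L} {g : L →ₐ[ℂ] F} {h : X.functionField →ₐ[ℂ] F}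
    (hfg : ∀ φ, h φ = g (f φ)) (ω : Forms n X.functionField) :
    pullForm n h ω = pullForm n g (pullForm n f ω) := by
  subst hn
  obtain ⟨t, ht⟩ := exists_isLocalCoords_genericPoint (X := X)
  obtain ⟨a, rfl⟩ := exists_eq_smul_coordForm ht ω
  simp only [coordForm, pullForm_smul, pullForm_dWedge, hfg]

/-- An embedding of function fields of the same dimension maps a transcendence basis to a
transcendence basis, so pull-back of forms of top degree is injective. -/
lemma pullForm_ne_zero {n : ℕ} (hY : dim Y = n) (hX : dim X = n)
    (f : X.functionField →ₐ[ℂ] Y.functionField) {ω : Forms n X.functionField} (hω : ω ≠ 0) :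
    pullForm n f ω ≠ 0 := by
  obtain ⟨S, hS⟩ := exists_finset_isTranscendenceBasis (K := ℂ) (L := X.functionField)
  have hS' := hS.comp_equiv S.equivFin.symm
  obtain ⟨b, hb⟩ := exists_basis_D_of_isTranscendenceBasis hS'
  obtain rfl : S.card = n := by
    rw [← hX, ← finrank_functionField, Module.finrank_eq_card_basis b, Fintype.card_fin]
  have hle : Algebra.trdeg ℂ Y.functionField ≤ Cardinal.mk (Fin S.card) := by
    obtain ⟨T, hT⟩ := exists_finset_isTranscendenceBasis (K := ℂ) (L := Y.functionField)
    have h := hT.cardinalMk_eq_trdeg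
    rw [dim, ← h] at hY
    rw [← h, Cardinal.mk_fin, ← hY]
    simp
  obtain ⟨c, hc⟩ := exists_basis_D_of_isTranscendenceBasis
    ((hS'.1.map' (f := f) f.toRingHom.injective).isTranscendenceBasis_of_trdeg_le_of_finite hle)
  obtain ⟨a, rfl⟩ := exists_smul_dWedge_eq (s := fun i ↦ (S.equivFin.symm i : X.functionField))
    (by rw [← b.span_eq]; exact Submodule.span_mono (Set.range_subset_range_iff_exists_comp.mpr
      ⟨id, funext hb⟩)) ω
  have ha : a ≠ 0 := by rintro rfl; simp at hω
  rw [pullForm_smul, pullForm_dWedge]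
  have hc' : ⇑c = fun i ↦ KaehlerDifferential.D ℂ Y.functionField
    (f (S.equivFin.symm i : X.functionField)) := funext hc
  refine smul_ne_zero (by simpa using ha) (dWedge_ne_zero ?_ ?_)
  · exact hc' ▸ c.linearIndependent
  · exact hc' ▸ c.span_eq.ge

end PullFormOnVarieties

/-! ### The critical divisor -/

section CriticalDivisor
variable {X : Scheme.{0}} [X.Over SpecC] [IsVariety X] [IsNormalScheme X]
  (g : X ⟶ X) [Surjective g] [g.IsOver SpecC]

/-- The multiplicity of the Jacobian determinant is that of `div(g^*ω) - g^* div(ω)`: if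
`ω = a ds` and `g^* ds = J dt`, then `g^*ω = (g^*a) J dt`, and `a` is a local equation of `div(ω)`
near `g z`. -/
theorem criticalDivisor_eq_canonicalDifference (z : X) :
    criticalDivisor g z = canonicalDifference g z := by
  rw [criticalDivisor]
  split_ifs with h
  · obtain ⟨t, s, ht, hs, hJ⟩ := h.choose_spec
    generalize h.choose = J at hJ ⊢
    obtain ⟨a, ha⟩ := exists_eq_smul_coordForm hs (canonicalForm X)
    have ha0 : a ≠ 0 := by
      rintro rfl
      exact canonicalForm_ne_zero (X := X) (by simpa using ha)
    have hJ0 : J ≠ 0 := by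
      rintro rfl
      exact pullForm_ne_zero rfl rfl (pullFun g) (coordForm_ne_zero hs) (by simpa using hJ)
    have h1 : ordDiv g z (divForm (canonicalForm X)) = ordFun g z a / (1 : ℕ) :=
      ordDiv_eq g one_pos (by
        simpa using isLocalEquation_divForm hs ha canonicalForm_ne_zero)
    rw [canonicalDifference, h1, divForm, ordForm_of_eq_smul_coordForm ht
      (a := pullFun g a * J) (by rw [ha, pullForm_smul, hJ, smul_smul]),
      Scheme.ord_mul (pullFun_ne_zero g ha0) hJ0, ordFun]
    push_cast
    ring
  · rfl

/-- Since `C_g = div(g^*ω) - g^* div(ω)`, with `g^*ω = J ω` the divisor `m C_g` has the local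
equation `Jᵐ φ / g^*ψ`, where `φ` and `ψ` are local equations of `m div(ω)`. -/
lemma isLocalEquation_criticalDivisor {m : ℕ} (hm : 0 < m) {y : X} {φ ψ J : X.functionField}
    (hφ : IsLocalEquation (fun z ↦ m * divForm (canonicalForm X) z) y φ)
    (hψ : IsLocalEquation (fun z ↦ m * divForm (canonicalForm X) z) (g y) ψ)
    (hJ0 : J ≠ 0) (hJ : pullForm (dim X) (pullFun g) (canonicalForm X) = J • canonicalForm X) :
    IsLocalEquation (fun z ↦ m * criticalDivisor g z) y (J ^ m * φ / pullFun g ψ) := by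
  obtain ⟨hφ0, U, hyU, hU⟩ := hφ
  obtain ⟨hψ0, V, hyV, hV⟩ := hψ
  have hψ0' := pullFun_ne_zero g hψ0
  have hJm := pow_ne_zero m hJ0
  refine ⟨div_ne_zero (mul_ne_zero hJm hφ0) hψ0', U ⊓ g ⁻¹ᵁ V, ⟨hyU, hyV⟩,
    fun z ⟨hzU, hzV⟩ hz ↦ ?_⟩
  have h1 : ordDiv g z (divForm (canonicalForm X)) = ordFun g z ψ / m :=
    ordDiv_eq g hm ⟨hψ0, V, hzV, hV⟩
  have h2 := hU z hzU hz
  dsimp only at h2 ⊢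
  rw [criticalDivisor_eq_canonicalDifference, canonicalDifference, h1, hJ, divForm,
    ordForm_smul rfl hz hJ0 canonicalForm_ne_zero, ord_div (mul_ne_zero hJm hφ0) hψ0',
    Scheme.ord_mul hJm hφ0, ord_pow hJ0]
  rw [divForm] at h2
  push_cast
  rw [h2, ordFun]
  field_simp

end CriticalDivisor

/-! ### Open subschemes -/

section Opens
variable {X : Scheme.{0}}

lemma coheight_eq_of_isOpenImmersion [IsIntegral X] {Y : Scheme.{0}} [IsIntegral Y]
    (f : Y ⟶ X) [IsOpenImmersion f] (y : Y) :
    coheight y = coheight (f y) := by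
  have h := ringKrullDim_eq_of_ringEquiv (asIso (f.stalkMap y)).commRingCatIsoToRingEquiv
  rw [ringKrullDim_stalk_eq_coheight, ringKrullDim_stalk_eq_coheight] at h
  exact_mod_cast h.symm

instance isNormalScheme_opens [IsNormalScheme X] (U : X.Opens) : IsNormalScheme U.toScheme where
  isDomain_stalk x := by
    have := IsNormalScheme.isDomain_stalk (U.ι x)
    exact (asIso (U.ι.stalkMap x)).commRingCatIsoToRingEquiv.symm.toMulEquiv.isDomain _
  isIntegrallyClosed_stalk x := by
    have := IsNormalScheme.isIntegrallyClosed_stalk (U.ι x)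
    exact .of_equiv (asIso (U.ι.stalkMap x)).commRingCatIsoToRingEquiv

end Opens

/-! ### Ramification of the rational lift -/

section Lift
variable {X Y Y' : Scheme.{0}} [X.Over SpecC] [Y.Over SpecC] [Y'.Over SpecC]
  [IsVariety X] [IsVariety Y] [IsVariety Y'] [IsNormalScheme Y']

lemma dim_eq_of_isBirationalMorphism (π : Y ⟶ X) [π.IsOver SpecC] [IsBirationalMorphism π] :
    dim Y = dim X :=
  dim_eq_of_bijective _ (pullFun_bijective π)

/-- The factor `r` is determined by the valuations, because `ord_{E'}` takes the value one. -/
lemma PushforwardOrdEq.eq {g : X ⟶ X} [g.IsOver SpecC] [Surjective g]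
    {π : Y ⟶ X} [π.IsOver SpecC] [IsBirationalMorphism π]
    {π' : Y' ⟶ X} [π'.IsOver SpecC] [IsBirationalMorphism π']
    {e : Y} {e' : Y'} (he' : coheight e' = 1) {r r' : ℕ} (h : PushforwardOrdEq g π π' e e' r)
    (h' : PushforwardOrdEq g π π' e e' r') : r = r' := by
  obtain ⟨ψ, hψ0, hψ⟩ := exists_ord_eq_one he'
  obtain ⟨φ, rfl⟩ := (pullFun_bijective π').2 ψ
  have hφ : φ ≠ 0 := by rintro rfl; simp at hψ0
  have h1 := (h φ hφ).symm.trans (h' φ hφ)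
  rw [ordFun, hψ] at h1
  simpa using h1

variable [IsNormalScheme Y]

/-- Orders of functions and of forms do not change on restriction to an open subset; the
ramification index of an open immersion is one because every rational function on `U` comes from
`Y`. -/
theorem ord_restrict {n : ℕ} (hn : dim Y = n) {U : Y.Opens} [Nonempty U] [IsDominant U.ι]
    [U.ι.IsOver SpecC] (u : U.toScheme) (hu : coheight (U.ι u) = 1) :
    (∀ φ : Y.functionField, φ ≠ 0 → ordFun U.ι u φ = Scheme.ord φ (U.ι u)) ∧
    ∀ η : Forms n Y.functionField, η ≠ 0 →
      ordForm (pullForm n (pullFun U.ι) η) u = ordForm η (U.ι u) := by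
  have hbij : Function.Bijective (pullFun U.ι) :=
    ⟨(pullFun U.ι).toRingHom.injective, pullFun_surjective_of_isOpenImmersion U.ι⟩
  have hu' : coheight u = 1 := (coheight_eq_of_isOpenImmersion U.ι u).trans hu
  obtain ⟨r, hr, h1, h2⟩ := exists_ramificationIndex U.ι
    ((dim_eq_of_bijective _ hbij).trans hn) hn hu' hu
  obtain rfl : r = 1 := by
    obtain ⟨ψ, hψ0, hψ⟩ := exists_ord_eq_one hu'
    obtain ⟨φ, rfl⟩ := hbij.2 ψ
    have h := h1 φ (by rintro rfl; simp at hψ0)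
    rw [ordFun, hψ] at h
    exact Nat.dvd_one.mp (Int.natCast_dvd_natCast.mp ⟨_, h⟩)
  refine ⟨fun φ hφ ↦ by simpa using h1 φ hφ, fun η hη ↦ by simpa using h2 η hη⟩

/-- The ramification index `r` of the rational lift of `g` along `E` satisfies
`g_* ord_E = r ord_{E'}` and multiplies the log order of forms: since `π' ∘ ḡ = g ∘ π`, the form
`π^*g^*ω` is the pull-back of `π'^*ω` by the lift. -/
theorem LiftMapsTo.exists_ramificationIndex {g : X ⟶ X} [g.IsOver SpecC] [Surjective g]
    {π : Y ⟶ X} [π.IsOver SpecC] [IsBirationalMorphism π]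
    {π' : Y' ⟶ X} [π'.IsOver SpecC] [IsBirationalMorphism π']
    {e : Y} (he : coheight e = 1) {e' : Y'} (he' : coheight e' = 1)
    (hlift : LiftMapsTo g π π' e e') :
    π' e' = g (π e) ∧ ∃ r : ℕ, 0 < r ∧ PushforwardOrdEq g π π' e e' r ∧
      ∀ ω : Forms (dim X) X.functionField, ω ≠ 0 →
        ordForm (pullForm (dim X) (pullFun π) (pullForm (dim X) (pullFun g) ω)) e + 1 =
          r * (ordForm (pullForm (dim X) (pullFun π') ω) e' + 1) := by
  obtain ⟨U, heU, h, hcomp, rfl⟩ := hlift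
  have : Nonempty U := ⟨⟨e, heU⟩⟩
  have : IsDominant U.ι := isDominant_of_isOpenImmersion U.ι
  have : U.ι.IsOver SpecC := ⟨rfl⟩
  have : IsDominant (h ≫ π') := by rw [hcomp]; infer_instance
  have : IsDominant h := isDominant_of_comp_birational π'
  have : (U.ι ≫ π ≫ g).IsOver SpecC := inferInstance
  have : h.IsOver SpecC := ⟨by
    rw [← comp_over π' SpecC, reassoc_of% hcomp]
    simp⟩
  have hfun (φ : X.functionField) :
      pullFun U.ι (pullFun π (pullFun g φ)) = pullFun h (pullFun π' φ) := by
    rw [← pullFun_comp (f := π) (g := g) rfl, ← pullFun_comp rfl, ← pullFun_comp hcomp]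
  have hY := dim_eq_of_isBirationalMorphism π
  have hY' := dim_eq_of_isBirationalMorphism π'
  have hU : dim U.toScheme = dim X := (dim_eq_of_bijective _ ⟨(pullFun U.ι).toRingHom.injective,
    pullFun_surjective_of_isOpenImmersion U.ι⟩).trans hY
  let u : U.toScheme := ⟨e, heU⟩
  have hu : coheight u = 1 := (coheight_eq_of_isOpenImmersion U.ι u).trans he
  obtain ⟨h1, h2⟩ := ord_restrict hY (U := U) u he
  obtain ⟨r, hr, h3, h4⟩ := DiscrepancyPullback.exists_ramificationIndex h hU hY' hu he'
  refine ⟨congr($hcomp u), r, hr, fun φ hφ ↦ ?_, fun ω hω ↦ ?_⟩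
  · have h5 := h1 _ (pullFun_ne_zero π (pullFun_ne_zero g hφ))
    rw [ordFun, hfun] at h5
    exact h5.symm.trans (h3 _ (pullFun_ne_zero π' hφ))
  · have h5 := h2 _ (pullForm_ne_zero hY rfl (pullFun π) (pullForm_ne_zero rfl rfl (pullFun g) hω))
    rw [← pullForm_comp rfl (h := (pullFun π).comp (pullFun g)) (fun _ ↦ rfl),
      ← pullForm_comp rfl (h := (pullFun U.ι).comp ((pullFun π).comp (pullFun g))) (fun _ ↦ rfl),
      pullForm_comp rfl (f := pullFun π') (g := pullFun h) hfun,
      pullForm_comp rfl (f := pullFun g) (g := pullFun π) (fun _ ↦ rfl)] at h5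
    exact (congrArg (· + 1) h5.symm).trans
      (h4 _ (pullForm_ne_zero hY' rfl (pullFun π') hω))

end Lift

end DiscrepancyPullback

end

theorem mainTheorem10
    (X Y Y' : Scheme.{0}) [X.Over SpecC] [Y.Over SpecC] [Y'.Over SpecC]
    [IsVariety X] [IsNormalScheme X] [IsProjectiveVariety X] (hX : IsQFactorial X)
    [IsVariety Y] [IsNormalScheme Y] [IsVariety Y'] [IsNormalScheme Y']
    (g : X ⟶ X) [g.IsOver SpecC] [Surjective g]
    (π : Y ⟶ X) [π.IsOver SpecC] [IsBirationalMorphism π]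
    (π' : Y' ⟶ X) [π'.IsOver SpecC] [IsBirationalMorphism π']
    (e : Y) (he : coheight e = 1) (e' : Y') (he' : coheight e' = 1)
    (hlift : LiftMapsTo g π π' e e') :
    (∃ r : ℕ, 0 < r ∧ PushforwardOrdEq g π π' e e' r) ∧
    ∀ r : ℕ, PushforwardOrdEq g π π' e e' r →
      (r : ℚ) * logDiscrepancy π' e' = logDiscrepancy π e + ordDiv π e (criticalDivisor g) := by
  obtain ⟨hee', r₀, hr₀, hpush, hform⟩ := hlift.exists_ramificationIndex he he'
  refine ⟨⟨r₀, hr₀, hpush⟩, fun r hr ↦ ?_⟩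
  obtain rfl := hr.eq he' hpush
  have hω := canonicalForm_ne_zero (X := X)
  obtain ⟨m, hm, hloc⟩ := exists_isLocalEquation_divForm hX hω
  obtain ⟨φ, hφ⟩ := hloc (π e)
  obtain ⟨ψ, hψ⟩ := hloc (g (π e))
  obtain ⟨J, hJ⟩ := exists_eq_smul_of_ne_zero hω (pullForm (dim X) (pullFun g) (canonicalForm X))
  have hgω := pullForm_ne_zero rfl rfl (pullFun g) hω
  have hJ0 : J ≠ 0 := by rintro rfl; simp [hJ] at hgω
  have hm0 : (m : ℚ) ≠ 0 := by positivity
  have h1 := ordDiv_eq π hm hφ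
  have h2 := ordDiv_eq π' (e := e') hm (hee' ▸ hψ)
  have h3 := ordDiv_eq π hm (isLocalEquation_criticalDivisor g hm hφ hψ hJ0 hJ)
  have hψ' := pullFun_ne_zero g hψ.1
  have hJm := pow_ne_zero m hJ0
  rw [ordFun_div π e (mul_ne_zero hJm hφ.1) hψ', ordFun_mul π e hJm hφ.1, ordFun_pow π e hJ0,
    hr ψ hψ.1] at h3
  -- the ramification formula for `ω`, with `π^* g^* ω` expanded as `π^* J • π^* ω`
  have h4 := hform _ hω
  rw [hJ, pullForm_smul, ordForm_smul (dim_eq_of_isBirationalMorphism π) he (pullFun_ne_zero π hJ0)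
    (pullForm_ne_zero (dim_eq_of_isBirationalMorphism π) rfl (pullFun π) hω)] at h4
  have h4' : (Scheme.ord (pullFun π J) e +
      ordForm (pullForm (dim X) (pullFun π) (canonicalForm X)) e + 1 : ℚ) =
      r * (ordForm (pullForm (dim X) (pullFun π') (canonicalForm X)) e' + 1) := by
    exact_mod_cast h4
  simp only [logDiscrepancy, relCanonicalDivisor, canonicalDifference, divForm] at h1 h2 ⊢
  rw [h1, h2, h3, show ordFun π e J = Scheme.ord (pullFun π J) e from rfl]
  push_cast
  field_simp
  linear_combination (-(m : ℚ)) * h4'
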